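/- There exists an integer $\Delta_0\ge 1$ such that the following holds. Let $D$ be a finite digraph without loops or parallel arcs (two opposite arcs between the same pair of vertices are allowed). For a vertex $v$, let $N^+(v)$ and $N^-(v)$ be its sets of out- and in-neighbours, $d^{\pm}(v)=|N^{\pm}(v)|$, and let $m^{\pm}(v)$ be the number of arcs of the subdigraph of $D$ induced by $N^{\pm}(v)$. Put $\Delta=\Delta_{\max}(D)=\max_{v\in V(D)}\max(d^+(v),d^-(v))$, and suppose that $\Delta>\Delta_0$. Let $B$ be a real number with $B>\Delta\log^3\Delta$ (that is, $B>\Delta(\log\Delta)^3$, with $\log$ the natural logarithm), and suppose that $D$ is $B$-sparse, i.e. for every vertex $v$ of $D$, $$\min\bigl(m^+(v),m^-(v)\bigr)\le \Delta(\Delta-1)-B .$$ Then $$\vec{\chi}(D)\le(\Delta+1)-\frac{B}{4e^7\Delta},$$ where the dichromatic number $\vec{\chi}(D)$ is the least $k\in\mathbb N$ for which the vertices of $D$ can be coloured with $k$ colours such that every colour class induces a subdigraph with no directed cycle (two opposite arcs count as a directed cycle). -/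

import Mathlib

noncomputable section

namespace Digraph

variable {V : Type*}

/-- `D` has no loop. A `Digraph` has no parallel arcs, and pairs of opposite arcs are allowed. -/
def IsLoopless (D : Digraph V) : Prop := ∀ v : V, ¬ D.Adj v v

section Degrees

variable [Fintype V]

open Classical in
/-- The out-neighbourhood `N⁺(v)`. -/
def outNbhd (D : Digraph V) (v : V) : Finset V := Finset.univ.filter fun w => D.Adj v w

open Classical in
/-- The in-neighbourhood `N⁻(v)`. -/
def inNbhd (D : Digraph V) (v : V) : Finset V := Finset.univ.filter fun u => D.Adj u v

/-- The out-degree `d⁺(v)`. -/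
def outDeg (D : Digraph V) (v : V) : ℕ := (D.outNbhd v).card

/-- The in-degree `d⁻(v)`. -/
def inDeg (D : Digraph V) (v : V) : ℕ := (D.inNbhd v).card

/-- `Δ_max(D)`: the maximum over all vertices `v` of `max (d⁺(v), d⁻(v))`
(`0` if there is no vertex). -/
def maxDeg (D : Digraph V) : ℕ := Finset.univ.sup fun v => max (D.outDeg v) (D.inDeg v)

end Degrees

open Classical in
/-- The number of arcs of the subdigraph of `D` induced by `S`. -/
def arcCount (D : Digraph V) (S : Finset V) : ℕ :=
  ((S ×ˢ S).filter fun p => D.Adj p.1 p.2).card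

/-- `D` is `B`-sparse: with `Δ = Δ_max(D)`, and `m⁺(v)`, `m⁻(v)` the numbers of arcs induced by
`N⁺(v)`, `N⁻(v)`, every vertex satisfies `min (m⁺(v), m⁻(v)) ≤ Δ(Δ - 1) - B` (over the reals). -/
def IsSparse [Fintype V] (D : Digraph V) (B : ℝ) : Prop :=
  ∀ v : V, ((min (D.arcCount (D.outNbhd v)) (D.arcCount (D.inNbhd v)) : ℕ) : ℝ) ≤
    (D.maxDeg : ℝ) * ((D.maxDeg : ℝ) - 1) - B

/-- The subdigraph of `D` induced by `S` is acyclic: no vertex can be reached from itself by a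
directed walk of positive length inside `S` (equivalently, there is no directed cycle in `S`;
two opposite arcs are a directed cycle). -/
def IsAcyclicOn (D : Digraph V) (S : Set V) : Prop :=
  ∀ v : V, ¬ Relation.TransGen (fun x y => x ∈ S ∧ y ∈ S ∧ D.Adj x y) v v

/-- `c` is a `k`-dicolouring: every colour class induces an acyclic subdigraph. -/
def IsDicolouring (D : Digraph V) {k : ℕ} (c : V → Fin k) : Prop :=
  ∀ i : Fin k, D.IsAcyclicOn (c ⁻¹' {i})

/-- The dichromatic number: the least `k` such that `D` has a `k`-dicolouring. -/
def dichromaticNumber (D : Digraph V) : ℕ := sInf {k : ℕ | ∃ c : V → Fin k, D.IsDicolouring c}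

/-- On a finite loopless digraph the minimum defining the dichromatic number is attained. -/
theorem exists_isDicolouring_dichromaticNumber [Fintype V] (D : Digraph V) (hD : D.IsLoopless) :
    ∃ c : V → Fin D.dichromaticNumber, D.IsDicolouring c := by
  have hne : {k : ℕ | ∃ c : V → Fin k, D.IsDicolouring c}.Nonempty := by
    refine ⟨Fintype.card V, Fintype.equivFin V, ?_⟩
    intro i v hv
    have key : ∀ x y : V,
        ¬ (x ∈ (Fintype.equivFin V) ⁻¹' {i} ∧ y ∈ (Fintype.equivFin V) ⁻¹' {i} ∧ D.Adj x y) := by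
      rintro x y ⟨hx, hy, hxy⟩
      have h : x = y := (Fintype.equivFin V).injective (hx.trans hy.symm)
      exact hD y (h ▸ hxy)
    obtain ⟨x, hx, -⟩ := Relation.TransGen.head'_iff.mp hv
    exact key _ _ hx
  exact Nat.sInf_mem hne

end Digraph

end

/-! Let `x = B / (4 e ^ 7 Δ)` and `k = ⌊Δ + 1 - x⌋`. A random partial colouring is completed greedily
with `k` colours. A vertex `v` can be coloured last without closing a monochromatic cycle if some
colour is missing on its out-neighbourhood, or on its in-neighbourhood `N`; hence it is enough that
for each `v` one of the two contains at least `x - (Δ - |N|)` repetitions of colours among its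
coloured vertices (`Digraph.exists_extension`).

The partial colouring comes from an arbitrary linear order on the vertices and a uniform assignment
of `8 Δ` colours, only `k` of which count. A vertex keeps its colour if the colour is missing among
its earlier out-neighbours or among its earlier in-neighbours. Inserting the retained vertices in
order shows that colour classes are acyclic (`Digraph.isAcyclicOn_retained`), and the order makes the
process adapted: when the vertices are exposed one after the other, the fate of a vertex is decided
at once. Tail bounds therefore follow from exponential potentials that do not increase on average
(`sum_potential_le`), without further concentration inequalities.

Fix the sparse neighbourhood `N` of `v`. Its missing arcs, about `B` of them, are counted at the
later endpoint `y`; choosing the better of the two directions, `y` has a set `X y` of earlier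
vertices of `N` outside `Z y`, its earlier out- or in-neighbours, and the sizes of the `X y` sum up
to about `B / 2` (`Digraph.card_mul_card_le`). With very high probability at least `|X y| / 70`
colours are live for `y`, that is, occur on retained vertices of `X y` and not on `Z y`
(`Digraph.card_liveColours_lt_le`). Whenever `y` receives a live colour it is retained and repeats a
colour (`Digraph.card_image_add_card_hits_le`); so the number of repetitions dominates a sum of
conditionally independent trials with mean of order `B / Δ`, which is well above `x`
(`Digraph.card_hits_lt_le`). As `B / Δ > log ^ 3 Δ`, failure at `v` has probability smaller than any
power of `Δ`, while it depends on colours within distance two of `v` only, and the Lovász local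
lemma (`LocalLemma.exists_forall_notMem`) gives an assignment without failures. -/

noncomputable section

/-! ### The local lemma on a finite product space -/

namespace LocalLemma

open Finset

variable {ι α J : Type*} [Fintype ι] [DecidableEq ι] [Fintype α] [DecidableEq α]

/-- Independence of events that depend on disjoint sets of coordinates: exchanging the coordinates
outside `S` between two assignments is an involution that maps `(A ∩ B) × Ω` onto `A × B`. -/
theorem card_inter_mul_card_univ {S T : Finset ι} (hST : Disjoint S T) (A B : Finset (ι → α))
    (hA : ∀ f g, (∀ i ∈ S, f i = g i) → f ∈ A → g ∈ A)
    (hB : ∀ f g, (∀ i ∈ T, f i = g i) → f ∈ B → g ∈ B) :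
    (A ∩ B).card * Fintype.card (ι → α) = A.card * B.card := by
  rw [← Finset.card_univ, ← Finset.card_product, ← Finset.card_product]
  let φ : (ι → α) × (ι → α) → (ι → α) × (ι → α) := fun p =>
    (fun i => if i ∈ S then p.1 i else p.2 i, fun i => if i ∈ S then p.2 i else p.1 i)
  have hφ : ∀ p, φ (φ p) = p := by
    rintro ⟨f, g⟩
    ext i <;> by_cases hi : i ∈ S <;> simp [φ, hi]
  refine Finset.card_nbij' φ φ ?_ ?_ (fun p _ => hφ p) (fun p _ => hφ p)
  · rintro ⟨f, g⟩ h
    simp only [coe_product, Set.mem_prod, mem_coe, mem_inter, mem_univ, and_true] at h ⊢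
    refine ⟨hA f _ (fun i hi => by simp [φ, hi]) h.1, hB f _ (fun i hi => ?_) h.2⟩
    have : i ∉ S := fun h' => Finset.disjoint_left.mp hST h' hi
    simp [φ, this]
  · rintro ⟨f, g⟩ h
    simp only [coe_product, Set.mem_prod, mem_coe, mem_inter, mem_univ, and_true] at h ⊢
    refine ⟨hA f _ (fun i hi => by simp [φ, hi]) h.1, hB g _ (fun i hi => ?_) h.2⟩
    have : i ∉ S := fun h' => Finset.disjoint_left.mp hST h' hi
    simp [φ, this]

open Classical in
/-- The assignments that avoid every event `A j` with `j ∈ s`. -/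
def avoiding (A : J → Finset (ι → α)) (s : Finset J) : Finset (ι → α) :=
  univ.filter fun f => ∀ j ∈ s, f ∉ A j

theorem mem_avoiding {A : J → Finset (ι → α)} {s : Finset J} {f : ι → α} :
    f ∈ avoiding A s ↔ ∀ j ∈ s, f ∉ A j := by
  simp [avoiding]

theorem avoiding_anti (A : J → Finset (ι → α)) {s t : Finset J} (h : s ⊆ t) :
    avoiding A t ⊆ avoiding A s := by
  intro f hf
  simp only [mem_avoiding] at hf ⊢
  exact fun j hj => hf j (h hj)

variable [DecidableEq J] {A : J → Finset (ι → α)} {S : J → Finset ι} {Γ : J → Finset J}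
  {p : ℝ} {d : ℕ}

/-- The inductive core of the local lemma: conditionally on avoiding any set of events, an event
has probability at most `2p`. -/
theorem card_inter_avoiding_le (hdep : ∀ j f g, (∀ i ∈ S j, f i = g i) → f ∈ A j → g ∈ A j)
    (hΓ : ∀ j j', j' ∉ Γ j → Disjoint (S j) (S j')) (hd : ∀ j, (Γ j).card ≤ d)
    (hp : ∀ j, ((A j).card : ℝ) ≤ p * Fintype.card (ι → α)) (hpd : 4 * p * d ≤ 1)
    (hp0 : 0 ≤ p) (s : Finset J) : ∀ j,
    ((A j ∩ avoiding A s).card : ℝ) ≤ 2 * p * (avoiding A s).card := by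
  induction s using Finset.strongInduction with
  | H s ih =>
  intro j
  rcases isEmpty_or_nonempty (ι → α) with he | hne
  · simp [Finset.eq_empty_of_isEmpty]
  have hΩ : (0 : ℝ) < Fintype.card (ι → α) := by exact_mod_cast Fintype.card_pos
  set s₂ := s.filter (· ∉ Γ j) with hs₂
  set s₁ := s.filter (· ∈ Γ j) with hs₁
  -- The events indexed by `s₂` are independent of `A j`.
  have hind : ((A j ∩ avoiding A s₂).card : ℝ) ≤ p * (avoiding A s₂).card := by
    have := card_inter_mul_card_univ (S := S j) (T := s₂.biUnion S)
      (by
        rw [Finset.disjoint_biUnion_right]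
        exact fun i hi => hΓ j i (Finset.mem_filter.mp hi).2)
      (A j) (avoiding A s₂) (hdep j) (by
        intro f g hfg hf
        simp only [mem_avoiding] at hf ⊢
        intro i hi hg
        exact hf i hi (hdep i g f
          (fun x hx => (hfg x (Finset.mem_biUnion.mpr ⟨i, hi, hx⟩)).symm) hg))
    have h2 : ((A j ∩ avoiding A s₂).card : ℝ) * Fintype.card (ι → α)
        = (A j).card * (avoiding A s₂).card := by exact_mod_cast this
    have h3 : ((A j).card : ℝ) * (avoiding A s₂).card ≤
        p * Fintype.card (ι → α) * (avoiding A s₂).card :=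
      mul_le_mul_of_nonneg_right (hp j) (by positivity)
    refine le_of_mul_le_mul_right ?_ hΩ
    rw [h2]
    linarith
  have hle : ((A j ∩ avoiding A s).card : ℝ) ≤ (A j ∩ avoiding A s₂).card := by
    exact_mod_cast Finset.card_le_card
      (Finset.inter_subset_inter_left (avoiding_anti A (Finset.filter_subset _ _)))
  have hlow : ((avoiding A s₂).card : ℝ) ≤ 2 * (avoiding A s).card := by
    by_cases h1 : s₁ = ∅
    · have : s₂ = s := by
        rw [hs₂, Finset.filter_eq_self]
        intro x hx hxΓ
        have : x ∈ s₁ := Finset.mem_filter.mpr ⟨hx, hxΓ⟩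
        simp [h1] at this
      rw [this]
      have : (0 : ℝ) ≤ (avoiding A s).card := by positivity
      linarith
    · have hss : s₂ ⊂ s := by
        refine Finset.ssubset_iff_subset_ne.mpr ⟨Finset.filter_subset _ _, fun h => ?_⟩
        obtain ⟨x, hx⟩ := Finset.nonempty_iff_ne_empty.mpr h1
        have hx' := Finset.mem_filter.mp hx
        have : x ∈ s₂ := h ▸ hx'.1
        exact (Finset.mem_filter.mp this).2 hx'.2
      have hcov : avoiding A s₂ ⊆ avoiding A s ∪ s₁.biUnion fun i => A i ∩ avoiding A s₂ := by
        intro f hf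
        by_cases hf' : f ∈ avoiding A s
        · exact Finset.mem_union_left _ hf'
        · refine Finset.mem_union_right _ ?_
          have : ∃ i ∈ s, f ∈ A i := by
            by_contra hcon
            push Not at hcon
            exact hf' (mem_avoiding.mpr hcon)
          obtain ⟨i, hi, hfi⟩ := this
          have hi1 : i ∈ Γ j := by
            by_contra hcon
            have := mem_avoiding.mp hf i (Finset.mem_filter.mpr ⟨hi, hcon⟩)
            exact this hfi
          exact Finset.mem_biUnion.mpr ⟨i, Finset.mem_filter.mpr ⟨hi, hi1⟩,
            Finset.mem_inter.mpr ⟨hfi, hf⟩⟩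
      have h4 : ((avoiding A s₂).card : ℝ) ≤ (avoiding A s).card +
          ∑ i ∈ s₁, ((A i ∩ avoiding A s₂).card : ℝ) := by
        exact_mod_cast (Finset.card_le_card hcov).trans
          ((Finset.card_union_le _ _).trans (Nat.add_le_add_left Finset.card_biUnion_le _))
      have h5 : ∑ i ∈ s₁, ((A i ∩ avoiding A s₂).card : ℝ) ≤
          s₁.card * (2 * p * (avoiding A s₂).card) := by
        rw [← nsmul_eq_mul]
        exact Finset.sum_le_card_nsmul _ _ _ fun i _ => ih s₂ hss i
      have h6 : (s₁.card : ℝ) ≤ d := by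
        refine le_trans ?_ (Nat.cast_le.mpr (hd j))
        exact_mod_cast Finset.card_le_card fun x hx => (Finset.mem_filter.mp hx).2
      have h7 : (s₁.card : ℝ) * (2 * p * (avoiding A s₂).card) ≤
          d * (2 * p * (avoiding A s₂).card) := mul_le_mul_of_nonneg_right h6 (by positivity)
      have h8 : 4 * p * d * ((avoiding A s₂).card : ℝ) ≤ 1 * (avoiding A s₂).card :=
        mul_le_mul_of_nonneg_right hpd (by positivity)
      nlinarith
  nlinarith [mul_le_mul_of_nonneg_left hlow hp0]

/-- The symmetric Lovász local lemma for uniform assignments `ι → α`: the event `A j` depends on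
the coordinates in `S j` only, and `Γ j` contains all indices whose coordinates meet `S j`. -/
theorem exists_forall_notMem [Fintype J] [Nonempty α]
    (hdep : ∀ j f g, (∀ i ∈ S j, f i = g i) → f ∈ A j → g ∈ A j)
    (hΓ : ∀ j j', j' ∉ Γ j → Disjoint (S j) (S j')) (hd : ∀ j, (Γ j).card ≤ d)
    (hp : ∀ j, ((A j).card : ℝ) ≤ p * Fintype.card (ι → α)) (hpd : 4 * p * d ≤ 1)
    (hp0 : 0 ≤ p) (hd1 : 1 ≤ d) : ∃ f, ∀ j, f ∉ A j := by
  have hp2 : 2 * p < 1 := by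
    have : (1 : ℝ) ≤ d := by exact_mod_cast hd1
    nlinarith
  have key : ∀ s : Finset J, (avoiding A s).Nonempty := by
    intro s
    induction s using Finset.induction_on with
    | empty => exact ⟨fun _ => Classical.arbitrary α, mem_avoiding.mpr (by simp)⟩
    | insert j s _ ih =>
      have h1 := card_inter_avoiding_le hdep hΓ hd hp hpd hp0 s j
      have h2 : (0 : ℝ) < (avoiding A s).card := by exact_mod_cast ih.card_pos
      have h3 : (A j ∩ avoiding A s).card < (avoiding A s).card := by
        have : ((A j ∩ avoiding A s).card : ℝ) < (avoiding A s).card := by nlinarith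
        exact_mod_cast this
      obtain ⟨f, hf, hf'⟩ := Finset.exists_mem_notMem_of_card_lt_card h3
      refine ⟨f, ?_⟩
      have hfA : f ∉ A j := fun h => hf' (Finset.mem_inter.mpr ⟨h, hf⟩)
      simp only [mem_avoiding] at hf ⊢
      intro i hi
      rcases Finset.mem_insert.mp hi with rfl | hi
      exacts [hfA, hf i hi]
  obtain ⟨f, hf⟩ := key univ
  exact ⟨f, fun j => mem_avoiding.mp hf j (Finset.mem_univ j)⟩

end LocalLemma

/-! ### Exposing a random assignment in order -/

section Exposure

open Finset Function

variable {V α : Type*} [Fintype V] [LinearOrder V] [Fintype α]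

/-- `f` with the coordinates outside `S` replaced by `o`. -/
def maskOff (o : α) (S : Finset V) (f : V → α) : V → α := fun v => if v ∈ S then f v else o

/-- Resampling one coordinate preserves the uniform distribution. -/
theorem sum_sum_update (a : V) (F : (V → α) → ℝ) :
    ∑ f : V → α, ∑ c : α, F (update f a c) = Fintype.card α * ∑ f : V → α, F f := by
  have h2 : ∑ f : V → α, ∑ c : α, F (update f a c) =
      ∑ q : (V → α) × α, F (update q.1 a q.2) := by
    rw [Fintype.sum_prod_type]
  rw [h2]
  have h3 : ∑ q : (V → α) × α, F (update q.1 a q.2) = ∑ q : (V → α) × α, F q.1 := by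
    refine Fintype.sum_bijective (fun q => (update q.1 a q.2, q.1 a)) ?_ _ _ (fun q => rfl)
    refine Function.Involutive.bijective ?_
    rintro ⟨f, c⟩
    simp
  rw [h3, Fintype.sum_prod_type]
  simp [Finset.mul_sum]

/-- A supermartingale estimate. `Ψ S g` is a potential for the state in which the vertices of `S`
are exposed, `g` being their colours and the dummy colour `o` elsewhere. If revealing the colour of
a vertex beyond `S` does not increase the potential on average, the potential of the full
assignment is on average at most the initial one. -/
theorem sum_potential_le (o : α) (Ψ : Finset V → (V → α) → ℝ)
    (hstep : ∀ (S : Finset V) (a : V) (g : V → α), (∀ x ∈ S, x < a) → (∀ x, x ∉ S → g x = o) →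
      ∑ c : α, Ψ (insert a S) (update g a c) ≤ Fintype.card α * Ψ S g) :
    ∑ f : V → α, Ψ univ f ≤ Fintype.card (V → α) * Ψ ∅ fun _ => o := by
  rcases isEmpty_or_nonempty α with hα | hα
  · exact isEmptyElim o
  have hM : (0 : ℝ) < Fintype.card α := by exact_mod_cast Fintype.card_pos
  have key : ∀ S : Finset V, ∑ f : V → α, Ψ S (maskOff o S f) ≤
      Fintype.card (V → α) * Ψ ∅ fun _ => o := by
    intro S
    have h0 : ∀ f : V → α, maskOff o ∅ f = fun _ => o := fun f => by ext v; simp [maskOff]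
    refine Finset.induction_on_max S (by simp [h0]) fun a S hS ih => ?_
    refine le_trans (le_of_mul_le_mul_left ?_ hM) ih
    rw [← sum_sum_update a (fun f => Ψ (insert a S) (maskOff o (insert a S) f)), Finset.mul_sum]
    refine Finset.sum_le_sum fun f _ => ?_
    have : ∀ c : α, maskOff o (insert a S) (update f a c) = update (maskOff o S f) a c := by
      intro c
      ext v
      by_cases hv : v = a
      · subst hv; simp [maskOff]
      · simp [maskOff, hv]
    simp only [this]
    exact hstep S a _ hS fun x hx => by simp [maskOff, hx]
  have h : ∀ f : V → α, maskOff o univ f = f := fun f => by ext v; simp [maskOff]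
  simpa only [h] using key univ

/-- Markov's inequality for an exponential moment over uniform assignments. -/
theorem card_filter_le_of_sum_le {P : (V → α) → Prop} [DecidablePred P] {F : (V → α) → ℝ}
    {t C : ℝ} (hF : ∀ f, 0 ≤ F f) (hP : ∀ f, P f → t ≤ F f) (ht : 0 < t)
    (hC : ∑ f : V → α, F f ≤ Fintype.card (V → α) * C) :
    ((univ.filter P).card : ℝ) ≤ C / t * Fintype.card (V → α) := by
  have h1 : ((univ.filter P).card : ℝ) * t ≤ ∑ f : V → α, F f := by
    rw [← nsmul_eq_mul]
    refine (Finset.card_nsmul_le_sum _ F t fun f hf => hP f (Finset.mem_filter.mp hf).2).trans ?_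
    exact Finset.sum_le_sum_of_subset_of_nonneg (Finset.filter_subset _ _) fun f _ _ => hF f
  rw [div_mul_eq_mul_div, le_div_iff₀ ht]
  linarith

end Exposure

/-! ### The random partial colouring -/

namespace Digraph

open Finset Function

section Activity

variable {V α : Type*} [DecidableEq α]

/-- The number of vertices of `Q` whose colour belongs to `K`. -/
def activity (K : Finset α) (g : V → α) (Q : Finset V) : ℕ := (Q.filter (g · ∈ K)).card

variable {K : Finset α} {g : V → α} {a : V}

theorem activity_mono {Q Q' : Finset V} (h : Q ⊆ Q') :
    activity K g Q ≤ activity K g Q' :=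
  Finset.card_le_card (Finset.filter_subset_filter _ h)

theorem card_image_inter_le_activity (Q : Finset V) :
    ((Q.image g) ∩ K).card ≤ activity K g Q := by
  refine (Finset.card_le_card ?_).trans (Finset.card_image_le (s := Q.filter (g · ∈ K)) (f := g))
  intro c hc
  rw [Finset.mem_inter, Finset.mem_image] at hc
  obtain ⟨⟨x, hx, rfl⟩, hK⟩ := hc
  exact Finset.mem_image_of_mem _ (Finset.mem_filter.mpr ⟨hx, hK⟩)

variable [DecidableEq V]

theorem activity_update_of_notMem {Q : Finset V} (ha : a ∉ Q) (c : α) :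
    activity K (update g a c) Q = activity K g Q := by
  unfold activity
  congr 1
  refine Finset.filter_congr fun x hx => ?_
  rw [update_of_ne (ne_of_mem_of_not_mem hx ha)]

theorem activity_update_le (a : V) (c : α) (Q : Finset V) :
    activity K (update g a c) Q ≤ activity K g Q + if c ∈ K then 1 else 0 := by
  unfold activity
  split_ifs with hc
  · refine (Finset.card_le_card (t := insert a (Q.filter (g · ∈ K))) fun x hx => ?_).trans
      (Finset.card_insert_le _ _)
    rw [Finset.mem_insert, Finset.mem_filter]
    rw [Finset.mem_filter] at hx
    by_cases hxa : x = a
    · exact Or.inl hxa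
    · rw [update_of_ne hxa] at hx
      exact Or.inr hx
  · refine Finset.card_le_card fun x hx => ?_
    rw [Finset.mem_filter] at hx ⊢
    by_cases hxa : x = a
    · subst hxa
      rw [update_self] at hx
      exact absurd hx.2 hc
    · rwa [update_of_ne hxa] at hx

theorem activity_le_activity_update (ha : g a ∉ K) (c : α) (Q : Finset V) :
    activity K g Q ≤ activity K (update g a c) Q := by
  refine Finset.card_le_card fun x hx => ?_
  rw [Finset.mem_filter] at hx ⊢
  have : x ≠ a := fun h => ha (h ▸ hx.2)
  rwa [update_of_ne this]

end Activity

variable {V α : Type*} [Fintype V] [LinearOrder V]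

/-- The out-neighbourhood (for `true`) or the in-neighbourhood (for `false`) of a vertex. -/
def nbhd (D : Digraph V) (b : Bool) (v : V) : Finset V := bif b then D.outNbhd v else D.inNbhd v

/-- The out- or in-neighbours of `v` that precede it in the order on the vertices. -/
def prior (D : Digraph V) (b : Bool) (v : V) : Finset V := (D.nbhd b v).filter (· < v)

/-- Of all colours in `α`, only those in `K` are used; a vertex whose colour is outside `K` counts
as uncoloured. A coloured vertex is retained if its colour is missing among its earlier
out-neighbours, or among its earlier in-neighbours. -/
def Retained (D : Digraph V) (K : Finset α) (g : V → α) (v : V) : Prop :=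
  g v ∈ K ∧ ∃ b, ∀ w ∈ D.prior b v, g w ≠ g v

open Classical in
/-- The colours that some retained vertex of `X` has and that are missing on `Z`. -/
def liveColours (D : Digraph V) (K : Finset α) (g : V → α) (X Z : Finset V) : Finset α :=
  K.filter fun c => (∃ x ∈ X, D.Retained K g x ∧ g x = c) ∧ ∀ z ∈ Z, g z ≠ c

variable {D : Digraph V} {K : Finset α} {g : V → α} {X Z S : Finset V} {o : α} {a v x : V}

theorem lt_of_mem_prior {b : Bool} (h : x ∈ D.prior b v) : x < v := (Finset.mem_filter.mp h).2

theorem mem_liveColours {c : α} : c ∈ D.liveColours K g X Z ↔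
    c ∈ K ∧ (∃ x ∈ X, D.Retained K g x ∧ g x = c) ∧ ∀ z ∈ Z, g z ≠ c := by
  simp [liveColours]

theorem retained_congr {f : V → α} (h : f v = g v)
    (h' : ∀ b, ∀ w ∈ D.prior b v, f w = g w) : D.Retained K f v ↔ D.Retained K g v := by
  unfold Retained
  rw [h]
  refine and_congr_right fun _ => exists_congr fun b => forall₂_congr fun w hw => ?_
  rw [h' b w hw]

theorem retained_update_iff (hva : v < a) (c : α) :
    D.Retained K (update g a c) v ↔ D.Retained K g v :=
  retained_congr (update_of_ne hva.ne _ _) fun _ _ hw =>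
    update_of_ne ((lt_of_mem_prior hw).trans hva).ne _ _

theorem liveColours_update_of_forall_lt (hX : ∀ x ∈ X, x < a) (hZ : ∀ z ∈ Z, z < a) (c : α) :
    D.liveColours K (update g a c) X Z = D.liveColours K g X Z := by
  ext i
  simp only [mem_liveColours]
  refine and_congr_right fun _ => and_congr (exists_congr fun x => and_congr_right fun hx => ?_)
    (forall₂_congr fun z hz => ?_)
  · rw [retained_update_iff (hX x hx), update_of_ne (hX x hx).ne]
  · rw [update_of_ne (hZ z hz).ne]

/-- Revealing a vertex after all coloured ones destroys at most the colour it receives, and only if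
it lies in `Z`. -/
theorem mem_liveColours_update (hS : ∀ x ∈ S, x < a) (hg : ∀ x, x ∉ S → g x = o) (ho : o ∉ K)
    {c i : α} (hi : i ∈ D.liveColours K g X Z) (hc : a ∈ Z → i ≠ c) :
    i ∈ D.liveColours K (update g a c) X Z := by
  rw [mem_liveColours] at hi ⊢
  obtain ⟨hK, ⟨x, hx, hr, rfl⟩, hz⟩ := hi
  have hxa : x < a := hS x (by
    by_contra h
    exact ho (hg x h ▸ hK))
  refine ⟨hK, ⟨x, hx, (retained_update_iff hxa c).mpr hr, update_of_ne hxa.ne _ _⟩, ?_⟩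
  intro z hzZ
  by_cases hza : z = a
  · subst hza
    rw [update_self]
    exact (hc hzZ).symm
  · rw [update_of_ne hza]
    exact hz z hzZ

/-! ### Exponential moments of activities, live colours and repetitions -/

variable [Fintype α] [DecidableEq α]

/-- Chernoff's bound for the activity of a set of at most `Δ` vertices, when an eighth of the
colours at most is used. -/
theorem card_activity_gt_le {Δ : ℕ} (hα : Fintype.card α = 8 * Δ) (hK : K.card ≤ Δ)
    (hΔ : 0 < Δ) (Q : Finset V) (hQ : Q.card ≤ Δ) :
    ((univ.filter fun f : V → α => (Δ : ℝ) / 4 < activity K f Q).card : ℝ) ≤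
      Real.exp (-(Δ : ℝ) / 32) * Fintype.card (V → α) := by
  have hΔ' : (0 : ℝ) < Δ := by exact_mod_cast hΔ
  have hMr : (Fintype.card α : ℝ) = 8 * Δ := by exact_mod_cast hα
  have he : Real.exp 1 ≤ 2.75 := by have := Real.exp_one_lt_d9; linarith
  obtain ⟨o, ho⟩ : ∃ o, o ∉ K := by
    by_contra! h
    have := Finset.card_eq_iff_eq_univ K |>.mpr (Finset.eq_univ_iff_forall.mpr h)
    omega
  have hmean : ∑ c : α, Real.exp (if c ∈ K then 1 else 0) ≤ 8 * Δ * Real.exp (7 / 32) := by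
    have h1 : ∀ c : α, Real.exp (if c ∈ K then 1 else 0) =
        1 + if c ∈ K then Real.exp 1 - 1 else 0 := fun c => by split_ifs <;> simp
    have h2 : (K.card : ℝ) ≤ Δ := by exact_mod_cast hK
    simp only [h1, Finset.sum_add_distrib, Finset.sum_const, Finset.card_univ, nsmul_eq_mul,
      Finset.sum_ite_mem, Finset.univ_inter, hMr]
    have h3 := Real.add_one_le_exp (7 / 32 : ℝ)
    have h4 : (K.card : ℝ) * (Real.exp 1 - 1) ≤ Δ * 1.75 :=
      mul_le_mul h2 (by linarith) (by linarith [Real.add_one_le_exp (1 : ℝ)]) hΔ'.le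
    nlinarith
  have key := sum_potential_le (V := V) o
    (fun S f => Real.exp ((activity K f Q : ℝ) - 7 / 32 * (Q ∩ S).card)) (by
      intro S a g hS _
      have haS : a ∉ S := fun h => lt_irrefl a (hS a h)
      by_cases haQ : a ∈ Q
      · have h1 : ((Q ∩ insert a S).card : ℝ) = (Q ∩ S).card + 1 := by
          rw [Finset.inter_insert_of_mem haQ, Finset.card_insert_of_notMem (by simp [haS])]
          push_cast; rfl
        have h2 : ∀ c : α, Real.exp ((activity K (update g a c) Q : ℝ) -
            7 / 32 * (Q ∩ insert a S).card) ≤ Real.exp ((activity K g Q : ℝ) -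
            7 / 32 * (Q ∩ S).card - 7 / 32) * Real.exp (if c ∈ K then 1 else 0) := by
          intro c
          rw [← Real.exp_add, Real.exp_le_exp, h1]
          have : (activity K (update g a c) Q : ℝ) ≤ activity K g Q + if c ∈ K then 1 else 0 := by
            exact_mod_cast activity_update_le a c Q
          linarith
        refine (Finset.sum_le_sum fun c _ => h2 c).trans ?_
        rw [← Finset.mul_sum]
        refine (mul_le_mul_of_nonneg_left hmean (Real.exp_pos _).le).trans (le_of_eq ?_)
        rw [hMr, Real.exp_sub _ (7 / 32)]
        field_simp
      · simp [activity_update_of_notMem haQ, Finset.inter_insert_of_notMem haQ])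
  refine (card_filter_le_of_sum_le (t := Real.exp ((Δ : ℝ) / 32)) (C := 1) (fun f => by positivity)
    (fun f hf => ?_) (Real.exp_pos _) (key.trans (le_of_eq ?_))).trans (le_of_eq ?_)
  · rw [Real.exp_le_exp, Finset.inter_univ]
    have : (Q.card : ℝ) ≤ Δ := by exact_mod_cast hQ
    linarith
  · simp [activity, ho]
  · rw [neg_div, Real.exp_neg, one_div]

/-- Linear growth of the set of live colours. While the vertices are exposed, each vertex of `X`
gains a live colour with probability at least `(|K| - 3 Δ / 4) / |α|` as long as the activities are
moderate, and each vertex of `Z` destroys one with probability `|live| / |α|`. The potential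
`exp (-λ |live|)`, with `λ` growing from `3 / 4` to `1` as the vertices of `Z` are exposed,
absorbs these losses. -/
theorem card_liveColours_lt_le {Δ : ℕ} (hα : Fintype.card α = 8 * Δ) (hΔ : 0 < Δ)
    (hK : (Δ : ℝ) * 0.9995 ≤ K.card) (ho : o ∉ K) (hXZ : Disjoint X Z) (hZ : Z.card ≤ Δ) (b : Bool) :
    ((univ.filter fun f : V → α => ((activity K f X : ℝ) ≤ Δ / 4 ∧ (activity K f Z : ℝ) ≤ Δ / 4 ∧
        ∀ x ∈ X, (activity K f (D.prior b x) : ℝ) ≤ Δ / 4) ∧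
        ((D.liveColours K f X Z).card : ℝ) < X.card / 70).card : ℝ) ≤
      Real.exp (-(X.card : ℝ) / 1000) * Fintype.card (V → α) := by
  have hΔ' : (0 : ℝ) < Δ := by exact_mod_cast hΔ
  have hMr : (Fintype.card α : ℝ) = 8 * Δ := by exact_mod_cast hα
  have hZr : (Z.card : ℝ) ≤ Δ := by exact_mod_cast hZ
  have he : Real.exp 1 ≤ 3 := by have := Real.exp_one_lt_d9; linarith
  have he34 : Real.exp (-(3 / 4)) ≤ 0.48 := by
    have h1 : (2.1 : ℝ) ≤ Real.exp (3 / 4) := by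
      have := Real.sum_le_exp_of_nonneg (x := 3 / 4) (by norm_num) 4
      norm_num [Finset.sum_range_succ, Nat.factorial] at this
      linarith
    rw [Real.exp_neg]
    exact (inv_anti₀ (by norm_num) h1).trans (by norm_num)
  set good : (V → α) → Prop := fun f => (activity K f X : ℝ) ≤ Δ / 4 ∧
    (activity K f Z : ℝ) ≤ Δ / 4 ∧ ∀ x ∈ X, (activity K f (D.prior b x) : ℝ) ≤ Δ / 4 with hgood
  set lam : Finset V → ℝ := fun S => 1 - 2 * (Z \ S).card / (8 * Δ) with hlam
  have hlam1 : ∀ S, lam S ≤ 1 := fun S => by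
    have : (0 : ℝ) ≤ 2 * (Z \ S).card / (8 * Δ) := by positivity
    simp only [hlam]; linarith
  have hlam2 : ∀ S, 3 / 4 ≤ lam S := fun S => by
    have h1 : ((Z \ S).card : ℝ) ≤ Δ :=
      le_trans (by exact_mod_cast Finset.card_le_card Finset.sdiff_subset) hZr
    have : 2 * ((Z \ S).card : ℝ) / (8 * Δ) ≤ 1 / 4 := by
      rw [div_le_iff₀ (by positivity)]; linarith
    simp only [hlam]; linarith
  -- The drift `0.0162` is at most `(0.2495 / 8) * 0.52`: a vertex of `X` gains a live colour with
  -- probability at least `0.2495 / 8`, and then the potential shrinks by a factor of at most `0.48`.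
  -- As `0.0162` exceeds `1 / 70`, the event `|live| < |X| / 70` is exponentially unlikely.
  have key := sum_potential_le (V := V) o
    (fun S f => if good f then Real.exp (0.0162 * (X ∩ S).card) *
      Real.exp (-(lam S * (D.liveColours K f X Z).card)) else 0) (by
      intro S a g hS hg
      have haS : a ∉ S := fun h => lt_irrefl a (hS a h)
      have hga : g a ∉ K := by rw [hg a haS]; exact ho
      have hgood_mono : ∀ c, good (update g a c) → good g := by
        intro c ⟨h1, h2, h3⟩
        have hle : ∀ Q : Finset V, (activity K g Q : ℝ) ≤ activity K (update g a c) Q := fun Q => by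
          exact_mod_cast activity_le_activity_update hga c Q
        exact ⟨(hle _).trans h1, (hle _).trans h2, fun x hx => (hle _).trans (h3 x hx)⟩
      by_cases hgg : good g
      swap
      · refine le_of_eq ?_
        rw [if_neg hgg, mul_zero]
        exact Finset.sum_eq_zero fun c _ => if_neg fun h => hgg (hgood_mono c h)
      rw [if_pos hgg]
      set A : ℝ := ((D.liveColours K g X Z).card : ℝ) with hA
      -- Dropping the indicator of the good event only increases the left-hand side.
      refine (Finset.sum_le_sum (g := fun c => Real.exp (0.0162 * (X ∩ insert a S).card) *
        Real.exp (-(lam (insert a S) * (D.liveColours K (update g a c) X Z).card)))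
        fun c _ => ?_).trans ?_
      · split_ifs
        · exact le_rfl
        · positivity
      rw [← Finset.mul_sum, hMr]
      set l := lam (insert a S) with hl
      have hl1 : l ≤ 1 := hlam1 _
      have hl2 : 3 / 4 ≤ l := hlam2 _
      by_cases haZ : a ∈ Z
      · have haX : a ∉ X := fun h => Finset.disjoint_left.mp hXZ h haZ
        have hlS : lam S = l - 2 / (8 * Δ) := by
          have h1 : (Z \ S).card = (Z \ insert a S).card + 1 := by
            rw [Finset.sdiff_insert, Finset.card_erase_of_mem (by simp [haZ, haS])]
            have : 0 < (Z \ S).card := Finset.card_pos.mpr ⟨a, by simp [haZ, haS]⟩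
            omega
          simp only [hl, hlam, h1]
          push_cast
          ring
        have h2 : ∀ c : α, Real.exp (-(l * (D.liveColours K (update g a c) X Z).card)) ≤
            Real.exp (-(l * A)) * (1 + if c ∈ D.liveColours K g X Z then 2 else 0) := by
          intro c
          split_ifs with hc
          · have h3 : A ≤ (D.liveColours K (update g a c) X Z).card + 1 := by
              have : (D.liveColours K g X Z).card ≤
                  (insert c (D.liveColours K (update g a c) X Z)).card :=
                Finset.card_le_card fun i hi => by
                  by_cases hic : i = c
                  · exact hic ▸ Finset.mem_insert_self _ _
                  · exact Finset.mem_insert_of_mem (mem_liveColours_update hS hg ho hi fun _ => hic)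
              rw [hA]
              exact_mod_cast this.trans (Finset.card_insert_le _ _)
            have h4 : -(l * (D.liveColours K (update g a c) X Z).card) ≤ -(l * A) + 1 := by
              nlinarith
            refine (Real.exp_le_exp.mpr h4).trans ?_
            rw [Real.exp_add]
            exact mul_le_mul_of_nonneg_left (by linarith) (Real.exp_pos _).le
          · rw [add_zero, mul_one, Real.exp_le_exp, neg_le_neg_iff]
            refine mul_le_mul_of_nonneg_left ?_ (by linarith)
            rw [hA]
            exact_mod_cast Finset.card_le_card fun i hi =>
              mem_liveColours_update hS hg ho hi fun _ => ne_of_mem_of_not_mem hi hc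
        have h5 : ∑ c : α, (1 + if c ∈ D.liveColours K g X Z then (2 : ℝ) else 0) =
            8 * Δ + A * 2 := by
          simp only [Finset.sum_add_distrib, Finset.sum_const, Finset.card_univ, nsmul_eq_mul,
            Finset.sum_ite_mem, Finset.univ_inter, hMr, mul_one, hA]
        have h6 : 8 * Δ + A * 2 ≤ 8 * Δ * Real.exp (2 / (8 * Δ) * A) := by
          have h7 := Real.add_one_le_exp (2 / (8 * Δ) * A)
          have h8 : 8 * Δ + A * 2 = 8 * Δ * (2 / (8 * Δ) * A + 1) := by field_simp; ring
          rw [h8]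
          exact mul_le_mul_of_nonneg_left h7 (by positivity)
        rw [Finset.inter_insert_of_notMem haX, mul_left_comm]
        refine mul_le_mul_of_nonneg_left ?_ (Real.exp_pos _).le
        refine (Finset.sum_le_sum fun c _ => h2 c).trans ?_
        rw [← Finset.mul_sum, h5]
        refine (mul_le_mul_of_nonneg_left h6 (Real.exp_pos _).le).trans (le_of_eq ?_)
        rw [mul_left_comm, ← Real.exp_add, hlS]
        congr 2
        ring
      have hlS : lam S = l := by
        simp only [hl, hlam, Finset.sdiff_insert_of_notMem haZ]
      have hmono : ∀ c : α, D.liveColours K g X Z ⊆ D.liveColours K (update g a c) X Z :=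
        fun c i hi => mem_liveColours_update hS hg ho hi fun h => absurd h haZ
      have hmono' : ∀ c : α, Real.exp (-(l * (D.liveColours K (update g a c) X Z).card)) ≤
          Real.exp (-(l * A)) := fun c => by
        rw [Real.exp_le_exp, neg_le_neg_iff]
        refine mul_le_mul_of_nonneg_left ?_ (by linarith)
        rw [hA]
        exact_mod_cast Finset.card_le_card (hmono c)
      rw [hlS]
      by_cases haX : a ∈ X
      swap
      · rw [Finset.inter_insert_of_notMem haX, mul_left_comm]
        refine mul_le_mul_of_nonneg_left ?_ (Real.exp_pos _).le
        refine (Finset.sum_le_card_nsmul _ _ _ fun c _ => hmono' c).trans (le_of_eq ?_)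
        rw [nsmul_eq_mul, Finset.card_univ, hMr]
      -- `G` consists of colours that become live if `a` receives them.
      set U : Finset α := (X.image g ∩ K) ∪ (Z.image g ∩ K) ∪ ((D.prior b a).image g ∩ K) with hU
      set G := K \ U with hG
      have hGcard : (Δ : ℝ) * 0.2495 ≤ G.card := by
        have h1 : (U.card : ℝ) ≤ 3 * (Δ / 4) := by
          have h2 : U.card ≤ activity K g X + activity K g Z + activity K g (D.prior b a) :=
            (Finset.card_union_le _ _).trans (add_le_add ((Finset.card_union_le _ _).trans
              (add_le_add (card_image_inter_le_activity X) (card_image_inter_le_activity Z)))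
              (card_image_inter_le_activity _))
          have h3 : (U.card : ℝ) ≤ activity K g X + activity K g Z +
            activity K g (D.prior b a) := by exact_mod_cast h2
          have h4 := hgg.1
          have h5 := hgg.2.1
          have h6 := hgg.2.2 a haX
          linarith
        have h2 : (K.card : ℝ) ≤ G.card + U.card := by
          exact_mod_cast Nat.sub_le_iff_le_add.mp (Finset.le_card_sdiff U K)
        linarith
      have h2 : ∀ c : α, Real.exp (-(l * (D.liveColours K (update g a c) X Z).card)) ≤
          Real.exp (-(l * A)) * (1 + if c ∈ G then -0.52 else 0) := by
        intro c
        split_ifs with hc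
        · rw [hG, hU, Finset.mem_sdiff] at hc
          obtain ⟨hcK, hc⟩ := hc
          simp only [Finset.mem_union, Finset.mem_inter, hcK, and_true, Finset.mem_image,
            not_or, not_exists, not_and] at hc
          obtain ⟨⟨hcX, hcZ⟩, hcP⟩ := hc
          have hnew : c ∈ D.liveColours K (update g a c) X Z := by
            refine mem_liveColours.mpr ⟨hcK, ⟨a, haX, ⟨?_, b, fun w hw => ?_⟩, update_self ..⟩,
              fun z hz => ?_⟩
            · rwa [update_self]
            · rw [update_self, update_of_ne (lt_of_mem_prior hw).ne]
              exact hcP w hw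
            · rw [update_of_ne (ne_of_mem_of_not_mem hz haZ)]
              exact hcZ z hz
          have hold : c ∉ D.liveColours K g X Z := fun h => by
            obtain ⟨-, ⟨x, hx, -, hxc⟩, -⟩ := mem_liveColours.mp h
            exact hcX x hx hxc
          have h3 : A + 1 ≤ (D.liveColours K (update g a c) X Z).card := by
            rw [hA]
            exact_mod_cast Finset.card_lt_card
              (Finset.ssubset_iff_subset_ne.mpr ⟨hmono c, fun h => hold (h ▸ hnew)⟩)
          have h4 : -(l * (D.liveColours K (update g a c) X Z).card) ≤ -(l * A) + -(3 / 4) := by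
            nlinarith
          refine (Real.exp_le_exp.mpr h4).trans ?_
          rw [Real.exp_add]
          exact mul_le_mul_of_nonneg_left (by linarith) (Real.exp_pos _).le
        · rw [add_zero, mul_one]
          exact hmono' c
      have h5 : ∑ c : α, (1 + if c ∈ G then (-0.52 : ℝ) else 0) = 8 * Δ + G.card * (-0.52) := by
        simp only [Finset.sum_add_distrib, Finset.sum_const, Finset.card_univ, nsmul_eq_mul,
          Finset.sum_ite_mem, Finset.univ_inter, hMr, mul_one]
      have h6 : 8 * Δ + G.card * (-0.52) ≤ 8 * Δ * Real.exp (-0.0162) := by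
        have h7 := Real.add_one_le_exp (-0.0162 : ℝ)
        nlinarith
      rw [Finset.inter_insert_of_mem haX, Finset.card_insert_of_notMem (by simp [haS])]
      refine (mul_le_mul_of_nonneg_left (Finset.sum_le_sum fun c _ => h2 c)
        (Real.exp_pos _).le).trans ?_
      rw [← Finset.mul_sum, h5]
      refine (mul_le_mul_of_nonneg_left (mul_le_mul_of_nonneg_left h6 (Real.exp_pos _).le)
        (Real.exp_pos _).le).trans (le_of_eq ?_)
      push_cast
      rw [show (0.0162 : ℝ) * ((X ∩ S).card + 1) = 0.0162 * (X ∩ S).card + 0.0162 by ring,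
        Real.exp_add, Real.exp_neg 0.0162]
      field_simp)
  refine (card_filter_le_of_sum_le (t := Real.exp (0.0162 * X.card - X.card / 70)) (C := 1)
    (fun f => by split_ifs <;> positivity)
    (fun f hf => ?_) (Real.exp_pos _) (key.trans (le_of_eq ?_))).trans ?_
  · rw [if_pos hf.1, ← Real.exp_add, Real.exp_le_exp, Finset.inter_univ]
    have := hf.2
    have h1 : lam univ = 1 := by
      simp only [hlam, Finset.sdiff_eq_empty_iff_subset.mpr (Finset.subset_univ Z),
        Finset.card_empty]
      simp
    rw [h1]
    linarith
  · have h0 : good fun _ => o := by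
      simp only [hgood, activity, ho, Finset.filter_false, Finset.card_empty, Nat.cast_zero]
      exact ⟨by positivity, by positivity, fun _ _ => by positivity⟩
    have h1 : D.liveColours K (fun _ => o) X Z = ∅ := by
      refine Finset.eq_empty_of_forall_notMem fun c hc => ?_
      obtain ⟨hK, ⟨x, -, -, rfl⟩, -⟩ := mem_liveColours.mp hc
      exact ho hK
    rw [if_pos h0, h1]
    simp
  · refine mul_le_mul_of_nonneg_right ?_ (by positivity)
    rw [one_div, ← Real.exp_neg, Real.exp_le_exp]
    have : (0 : ℝ) ≤ X.card := by positivity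
    linarith

/-- Lower tail of the number of vertices `y ∈ Y` whose colour is live for sets `X y`, `Z y` of
earlier vertices. -/
theorem card_hits_lt_le {Y : Finset V} {X Z : V → Finset V} (hX : ∀ y ∈ Y, ∀ x ∈ X y, x < y)
    (hZ : ∀ y ∈ Y, ∀ z ∈ Z y, z < y) (ℓ : V → ℝ) (t : ℝ) (hα : 0 < Fintype.card α) :
    ((univ.filter fun f : V → α => (∀ y ∈ Y, ℓ y ≤ (D.liveColours K f (X y) (Z y)).card) ∧
        ((Y.filter fun y => f y ∈ D.liveColours K f (X y) (Z y)).card : ℝ) < t).card : ℝ) ≤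
      Real.exp (t - 0.63 * ((∑ y ∈ Y, ℓ y) / Fintype.card α)) * Fintype.card (V → α) := by
  have hM : (0 : ℝ) < Fintype.card α := by exact_mod_cast hα
  have he : Real.exp (-1) ≤ 0.37 := by
    rw [Real.exp_neg]
    have := Real.exp_one_gt_d9
    exact (inv_anti₀ (by norm_num) (show (2.71 : ℝ) ≤ Real.exp 1 by linarith)).trans (by norm_num)
  obtain ⟨o⟩ : Nonempty α := Fintype.card_pos_iff.mp hα
  set L : V → (V → α) → Finset α := fun y f => D.liveColours K f (X y) (Z y) with hL
  -- The colour of `y ∈ Y` is live with probability at least `ℓ y / |α|`, given the earlier colours;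
  -- `0.63` is a lower bound for `1 - 1 / e`.
  have key := sum_potential_le (V := V) o
    (fun S f => if ∀ y ∈ Y ∩ S, ℓ y ≤ (L y f).card then
      Real.exp (0.63 * ((∑ y ∈ Y ∩ S, ℓ y) / Fintype.card α)) *
        Real.exp (-(((Y ∩ S).filter fun y => f y ∈ L y f).card : ℝ)) else 0) (by
      intro S a g hS _
      have haS : a ∉ S := fun h => lt_irrefl a (hS a h)
      have hLS : ∀ y ∈ Y, y ≤ a → ∀ c, L y (update g a c) = L y g := fun y hy hya c =>
        liveColours_update_of_forall_lt (fun x hx => (hX y hy x hx).trans_le hya)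
          (fun z hz => (hZ y hy z hz).trans_le hya) c
      have hold : ∀ c, (Y ∩ S).filter (fun y => update g a c y ∈ L y (update g a c)) =
          (Y ∩ S).filter fun y => g y ∈ L y g := fun c => by
        refine Finset.filter_congr fun y hy => ?_
        obtain ⟨hyY, hyS⟩ := Finset.mem_inter.mp hy
        rw [hLS y hyY (hS y hyS).le, update_of_ne (hS y hyS).ne]
      have hcond : ∀ c, (∀ y ∈ Y ∩ S, ℓ y ≤ (L y (update g a c)).card) ↔
          ∀ y ∈ Y ∩ S, ℓ y ≤ (L y g).card := fun c => by
        refine forall₂_congr fun y hy => ?_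
        obtain ⟨hyY, hyS⟩ := Finset.mem_inter.mp hy
        rw [hLS y hyY (hS y hyS).le]
      by_cases haY : a ∈ Y
      swap
      · simp only [Finset.inter_insert_of_notMem haY, hold, hcond]
        simp
      have haYS : a ∉ Y ∩ S := by simp [haS]
      simp only [Finset.inter_insert_of_mem haY, Finset.forall_mem_insert, hcond,
        Finset.filter_insert, hLS a haY le_rfl, update_self, hold]
      by_cases hc1 : ∀ y ∈ Y ∩ S, ℓ y ≤ (L y g).card
      swap
      · simp only [eq_false hc1, and_false, if_false, Finset.sum_const_zero, mul_zero, le_refl]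
      by_cases hc2 : ℓ a ≤ (L a g).card
      swap
      · simp only [hc2, false_and, if_false, Finset.sum_const_zero]
        positivity
      simp only [eq_true hc1, hc2, and_true, if_true]
      rw [Finset.sum_insert haYS, ← Finset.mul_sum]
      have h1 : ∀ c : α, Real.exp (-((if c ∈ L a g then
          insert a ((Y ∩ S).filter fun y => g y ∈ L y g) else
          (Y ∩ S).filter fun y => g y ∈ L y g).card : ℝ)) ≤
          Real.exp (-(((Y ∩ S).filter fun y => g y ∈ L y g).card : ℝ)) *
            (1 + if c ∈ L a g then -0.63 else 0) := fun c => by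
        split_ifs with hc
        · rw [Finset.card_insert_of_notMem (fun h => haYS (Finset.mem_filter.mp h).1)]
          push_cast
          rw [neg_add, Real.exp_add]
          exact mul_le_mul_of_nonneg_left (by linarith) (Real.exp_pos _).le
        · simp
      have h5 : ∑ c : α, (1 + if c ∈ L a g then (-0.63 : ℝ) else 0) =
          Fintype.card α + (L a g).card * (-0.63) := by
        simp only [Finset.sum_add_distrib, Finset.sum_const, Finset.card_univ, nsmul_eq_mul,
          Finset.sum_ite_mem, Finset.univ_inter, mul_one]
      have h6 : Fintype.card α + (L a g).card * (-0.63 : ℝ) ≤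
          Fintype.card α * Real.exp (-(0.63 * (ℓ a / Fintype.card α))) := by
        have h7 := Real.add_one_le_exp (-(0.63 * (ℓ a / Fintype.card α)))
        have h8 : Fintype.card α * (-(0.63 * (ℓ a / Fintype.card α)) + 1) =
            Fintype.card α + ℓ a * (-0.63) := by field_simp; ring
        have h9 := mul_le_mul_of_nonneg_left h7 hM.le
        rw [h8] at h9
        linarith
      refine (mul_le_mul_of_nonneg_left (Finset.sum_le_sum fun c _ => h1 c)
        (Real.exp_pos _).le).trans ?_
      rw [← Finset.mul_sum, h5]
      refine (mul_le_mul_of_nonneg_left (mul_le_mul_of_nonneg_left h6 (Real.exp_pos _).le)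
        (Real.exp_pos _).le).trans (le_of_eq ?_)
      rw [add_div, mul_add, Real.exp_add, Real.exp_neg (0.63 * (ℓ a / Fintype.card α))]
      field_simp)
  refine (card_filter_le_of_sum_le
    (t := Real.exp (0.63 * ((∑ y ∈ Y, ℓ y) / Fintype.card α) - t)) (C := 1)
    (fun f => by split_ifs <;> positivity)
    (fun f hf => ?_) (Real.exp_pos _) (key.trans (le_of_eq ?_))).trans (le_of_eq ?_)
  · simp only [Finset.inter_univ]
    rw [if_pos hf.1, ← Real.exp_add, Real.exp_le_exp]
    have := hf.2
    linarith
  · simp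
  · rw [one_div, ← Real.exp_neg, neg_sub]

end Digraph

/-! ### Acyclic sets and greedy completion -/

namespace Digraph

open Finset Function

section Greedy

variable {V α : Type*} {D : Digraph V}

/-- A vertex without out-arcs lies on no closed walk. -/
theorem transGen_avoiding_sink {r : V → V → Prop} {v : V} (hv : ∀ w, ¬ r v w) {x y : V}
    (h : Relation.TransGen r x y) (hy : y ≠ v) :
    Relation.TransGen (fun p q => r p q ∧ p ≠ v ∧ q ≠ v) x y := by
  induction h with
  | single h => exact .single ⟨h, fun e => hv _ (e ▸ h), hy⟩
  | @tail p q _ h ih =>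
    have hb : p ≠ v := fun e => hv _ (e ▸ h)
    exact (ih hb).tail ⟨h, hb, hy⟩

theorem isAcyclicOn_insert (hD : D.IsLoopless) {S : Set V} (hS : D.IsAcyclicOn S) {v : V}
    (hv : (∀ w ∈ S, ¬ D.Adj v w) ∨ ∀ w ∈ S, ¬ D.Adj w v) : D.IsAcyclicOn (insert v S) := by
  intro x hx
  rcases hv with hv | hv
  · have hsink : ∀ w, ¬ (v ∈ insert v S ∧ w ∈ insert v S ∧ D.Adj v w) := by
      rintro w ⟨-, rfl | hw, h⟩
      exacts [hD _ h, hv w hw h]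
    have hxv : x ≠ v := by
      rintro rfl
      obtain ⟨w, hw, -⟩ := Relation.TransGen.head'_iff.mp hx
      exact hsink w hw
    refine hS x (Relation.TransGen.mono ?_ _ _ (transGen_avoiding_sink hsink hx hxv))
    rintro p q ⟨⟨hp, hq, hpq⟩, hpv, hqv⟩
    exact ⟨hp.resolve_left hpv, hq.resolve_left hqv, hpq⟩
  · have hsource : ∀ w, ¬ (w ∈ insert v S ∧ v ∈ insert v S ∧ D.Adj w v) := by
      rintro w ⟨rfl | hw, -, h⟩
      exacts [hD _ h, hv w hw h]
    have hxv : x ≠ v := by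
      rintro rfl
      obtain ⟨w, -, hw⟩ := Relation.TransGen.tail'_iff.mp hx
      exact hsource w hw
    refine hS x (Relation.transGen_swap.mp
      (Relation.TransGen.mono ?_ _ _
        (transGen_avoiding_sink hsource (Relation.transGen_swap.mpr hx) hxv)))
    rintro p q ⟨⟨hp, hq, hpq⟩, hpv, hqv⟩
    exact ⟨hp.resolve_left hqv, hq.resolve_left hpv, hpq⟩

theorem isAcyclicOn_empty : D.IsAcyclicOn ∅ := fun _ hv => by
  obtain ⟨w, hw, -⟩ := Relation.TransGen.head'_iff.mp hv
  exact hw.1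

theorem dichromaticNumber_le_card (K : Finset α) {c : V → α}
    (hc : ∀ v, c v ∈ K) (hac : ∀ i, D.IsAcyclicOn {v | c v = i}) :
    D.dichromaticNumber ≤ K.card := by
  refine Nat.sInf_le ⟨fun v => K.equivFin ⟨c v, hc v⟩, fun i => ?_⟩
  have : (fun v => K.equivFin ⟨c v, hc v⟩) ⁻¹' {i} = {v | c v = (K.equivFin.symm i : α)} := by
    ext v
    simp only [Set.mem_preimage, Set.mem_singleton_iff, Set.mem_ofPred_eq]
    rw [← Equiv.eq_symm_apply, Subtype.ext_iff]
  rw [this]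
  exact hac _

variable [Fintype V]

theorem mem_nbhd_true {v w : V} : w ∈ D.nbhd true v ↔ D.Adj v w := by simp [nbhd, outNbhd]

theorem mem_nbhd_false {v w : V} : w ∈ D.nbhd false v ↔ D.Adj w v := by simp [nbhd, inNbhd]

theorem card_nbhd_le_maxDeg (b : Bool) (v : V) : (D.nbhd b v).card ≤ D.maxDeg := by
  have h : max (D.outDeg v) (D.inDeg v) ≤ D.maxDeg :=
    Finset.le_sup (f := fun v => max (D.outDeg v) (D.inDeg v)) (Finset.mem_univ v)
  cases b
  exacts [(le_max_right _ _).trans h, (le_max_left _ _).trans h]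

theorem isAcyclicOn_insert_of_nbhd (hD : D.IsLoopless) {S : Set V} (hS : D.IsAcyclicOn S) {v : V}
    (b : Bool) (hv : ∀ w ∈ S, w ∉ D.nbhd b v) : D.IsAcyclicOn (insert v S) := by
  cases b
  · exact isAcyclicOn_insert hD hS (Or.inr fun w hw h => hv w hw (mem_nbhd_false.mpr h))
  · exact isAcyclicOn_insert hD hS (Or.inl fun w hw h => hv w hw (mem_nbhd_true.mpr h))

/-- The retained vertices of one colour induce an acyclic subdigraph: insert them in order. -/
theorem isAcyclicOn_retained [LinearOrder V] (hD : D.IsLoopless) (K : Finset α) (f : V → α)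
    (i : α) : D.IsAcyclicOn {v | D.Retained K f v ∧ f v = i} := by
  have key : ∀ T : Finset V, D.IsAcyclicOn {v | v ∈ T ∧ D.Retained K f v ∧ f v = i} := by
    intro T
    refine Finset.induction_on_max T (by simpa using isAcyclicOn_empty) fun a T hT ih => ?_
    by_cases ha : D.Retained K f a ∧ f a = i
    · have : {v | v ∈ insert a T ∧ D.Retained K f v ∧ f v = i} =
          insert a {v | v ∈ T ∧ D.Retained K f v ∧ f v = i} := by
        ext v
        simp only [Finset.mem_insert, Set.mem_ofPred_eq, Set.mem_insert_iff]
        constructor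
        · rintro ⟨rfl | h, h'⟩
          exacts [Or.inl rfl, Or.inr ⟨h, h'⟩]
        · rintro (rfl | h)
          exacts [⟨Or.inl rfl, ha⟩, ⟨Or.inr h.1, h.2⟩]
      rw [this]
      obtain ⟨⟨-, b, hb⟩, hai⟩ := ha
      refine isAcyclicOn_insert_of_nbhd hD ih b fun w hw hwa => ?_
      exact hb w (Finset.mem_filter.mpr ⟨hwa, hT w hw.1⟩) (hw.2.2.trans hai.symm)
    · have : {v | v ∈ insert a T ∧ D.Retained K f v ∧ f v = i} =
          {v | v ∈ T ∧ D.Retained K f v ∧ f v = i} := by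
        ext v
        simp only [Finset.mem_insert, Set.mem_ofPred_eq]
        refine ⟨?_, fun h => ⟨Or.inr h.1, h.2⟩⟩
        rintro ⟨rfl | h, h'⟩
        exacts [absurd h' ha, ⟨h, h'⟩]
      rwa [this]
  simpa using key univ

/-- A partial dicolouring of `R` extends greedily to all vertices if every vertex has an out- or
in-neighbourhood in which the number of colours on `R` plus the number of uncoloured vertices is
less than the number of available colours. -/
theorem exists_extension [DecidableEq V] [DecidableEq α] (hD : D.IsLoopless) (K : Finset α) :
    ∀ (U R : Finset V) (c : V → α), (∀ v, v ∉ R → v ∈ U) → (∀ v ∈ R, c v ∈ K) →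
      (∀ i, D.IsAcyclicOn {v | v ∈ R ∧ c v = i}) →
      (∀ v, ∃ b, ((D.nbhd b v ∩ R).image c).card + (D.nbhd b v \ R).card < K.card) →
      ∃ c' : V → α, (∀ v, c' v ∈ K) ∧ ∀ i, D.IsAcyclicOn {v | c' v = i} := by
  intro U
  induction U using Finset.induction_on with
  | empty =>
    intro R c hU hK hac _
    have hR : ∀ v, v ∈ R := fun v => by
      by_contra h
      exact Finset.notMem_empty _ (hU v h)
    exact ⟨c, fun v => hK v (hR v), fun i => by simpa [hR] using hac i⟩
  | insert v U _ ih =>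
    intro R c hU hK hac hgr
    by_cases hvR : v ∈ R
    · refine ih R c (fun w hw => ?_) hK hac hgr
      exact (Finset.mem_insert.mp (hU w hw)).resolve_left fun h => hw (h ▸ hvR)
    obtain ⟨b, hb⟩ := hgr v
    obtain ⟨i, hiK, hi⟩ := Finset.exists_mem_notMem_of_card_lt_card
      ((Nat.le_add_right _ _).trans_lt hb)
    have hupd : ∀ w ∈ R, update c v i w = c w := fun w hw =>
      update_of_ne (ne_of_mem_of_not_mem hw hvR) _ _
    refine ih (insert v R) (update c v i) ?_ ?_ ?_ ?_
    · intro w hw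
      rw [Finset.mem_insert, not_or] at hw
      exact (Finset.mem_insert.mp (hU w hw.2)).resolve_left hw.1
    · intro w hw
      rcases Finset.mem_insert.mp hw with rfl | hw
      · rwa [update_self]
      · rw [hupd w hw]
        exact hK w hw
    · intro j
      by_cases hj : i = j
      · subst hj
        have : {w | w ∈ insert v R ∧ update c v i w = i} = insert v {w | w ∈ R ∧ c w = i} := by
          ext w
          by_cases hw : w = v
          · subst hw; simp
          · simp [hw]
        rw [this]
        refine isAcyclicOn_insert_of_nbhd hD (hac i) b fun w hw hwv => hi ?_
        exact Finset.mem_image.mpr ⟨w, Finset.mem_inter.mpr ⟨hwv, hw.1⟩, hw.2⟩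
      · have : {w | w ∈ insert v R ∧ update c v i w = j} = {w | w ∈ R ∧ c w = j} := by
          ext w
          by_cases hw : w = v
          · subst hw; simp [hj, hvR]
          · simp [hw]
        rw [this]
        exact hac j
    · intro w
      obtain ⟨b', hb'⟩ := hgr w
      refine ⟨b', lt_of_le_of_lt ?_ hb'⟩
      have himg : ((D.nbhd b' w ∩ R).image (update c v i)) = (D.nbhd b' w ∩ R).image c :=
        Finset.image_congr fun u hu => hupd u (Finset.mem_inter.mp hu).2
      by_cases hvN : v ∈ D.nbhd b' w
      · rw [Finset.inter_insert_of_mem hvN, Finset.image_insert, himg, Finset.sdiff_insert]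
        have h1 := Finset.card_erase_add_one (Finset.mem_sdiff.mpr ⟨hvN, hvR⟩)
        have h2 := Finset.card_insert_le (update c v i v) ((D.nbhd b' w ∩ R).image c)
        omega
      · rw [Finset.inter_insert_of_notMem hvN, himg, Finset.sdiff_insert_of_notMem hvN]

end Greedy

/-! ### Failure of greedy completion at a vertex -/

section BadEvents

variable {V α : Type*} [Fintype V] [LinearOrder V] {D : Digraph V} {K : Finset α}

open Classical in
/-- The set of retained vertices. -/
def retainedSet (D : Digraph V) (K : Finset α) (f : V → α) : Finset V :=
  univ.filter (D.Retained K f)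

theorem mem_retainedSet {f : V → α} {v : V} : v ∈ D.retainedSet K f ↔ D.Retained K f v := by
  simp [retainedSet]

/-- The vertices adjacent to `v` in either direction. -/
def adjacent (D : Digraph V) (v : V) : Finset V := D.nbhd true v ∪ D.nbhd false v

/-- The vertices that a walk of length one or two, in the underlying graph, can reach. -/
def within2 (D : Digraph V) (v : V) : Finset V := D.adjacent v ∪ (D.adjacent v).biUnion D.adjacent

theorem mem_adjacent_comm {v w : V} : w ∈ D.adjacent v ↔ v ∈ D.adjacent w := by
  simp only [adjacent, Finset.mem_union, mem_nbhd_true, mem_nbhd_false]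
  exact or_comm

theorem mem_within2_comm {v w : V} : w ∈ D.within2 v ↔ v ∈ D.within2 w := by
  simp only [within2, Finset.mem_union, Finset.mem_biUnion]
  refine or_congr mem_adjacent_comm (exists_congr fun u => ?_)
  rw [and_comm, mem_adjacent_comm, mem_adjacent_comm (v := v)]

theorem nbhd_subset_adjacent (b : Bool) (v : V) : D.nbhd b v ⊆ D.adjacent v := by
  cases b
  exacts [Finset.subset_union_right, Finset.subset_union_left]

theorem card_adjacent_le {Δ : ℕ} (hdeg : ∀ b v, (D.nbhd b v).card ≤ Δ) (v : V) :
    (D.adjacent v).card ≤ 2 * Δ := by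
  have := Finset.card_union_le (D.nbhd true v) (D.nbhd false v)
  have := hdeg true v
  have := hdeg false v
  unfold adjacent
  omega

theorem card_within2_le {Δ : ℕ} (hdeg : ∀ b v, (D.nbhd b v).card ≤ Δ) (v : V) :
    (D.within2 v).card ≤ 6 * Δ ^ 2 := by
  have h1 := Finset.card_union_le (D.adjacent v) ((D.adjacent v).biUnion D.adjacent)
  have h2 := Finset.card_biUnion_le_card_mul (D.adjacent v) D.adjacent (2 * Δ)
    fun u _ => card_adjacent_le hdeg u
  have h3 := card_adjacent_le hdeg v
  have h4 : (D.adjacent v).card * (2 * Δ) ≤ 2 * Δ * (2 * Δ) := Nat.mul_le_mul_right _ h3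
  have h5 : 2 * Δ ≤ 2 * Δ ^ 2 := by nlinarith [Nat.le_self_pow two_ne_zero Δ]
  unfold within2
  nlinarith

variable [DecidableEq α]

/-- Greedy completion may fail at `v`: in both neighbourhoods of `v`, the number of colours on
retained vertices plus the number of other vertices is at least the number of colours. -/
def Stuck (D : Digraph V) (K : Finset α) (v : V) (f : V → α) : Prop :=
  ∀ b, K.card ≤ ((D.nbhd b v ∩ D.retainedSet K f).image f).card +
    (D.nbhd b v \ D.retainedSet K f).card

theorem stuck_congr {v : V} {f g : V → α} (h : ∀ u ∈ D.within2 v, f u = g u) :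
    D.Stuck K v f ↔ D.Stuck K v g := by
  have h1 : ∀ b, ∀ u ∈ D.nbhd b v, f u = g u := fun b u hu =>
    h u (Finset.mem_union_left _ (nbhd_subset_adjacent b v hu))
  have h2 : ∀ b, ∀ u ∈ D.nbhd b v, (D.Retained K f u ↔ D.Retained K g u) := fun b u hu =>
    retained_congr (h1 b u hu) fun b' w hw => h w (Finset.mem_union_right _
      (Finset.mem_biUnion.mpr ⟨u, nbhd_subset_adjacent b v hu,
        nbhd_subset_adjacent b' u (Finset.mem_filter.mp hw).1⟩))
  refine forall_congr' fun b => ?_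
  have h3 : D.nbhd b v ∩ D.retainedSet K f = D.nbhd b v ∩ D.retainedSet K g := by
    ext u
    simp only [Finset.mem_inter, mem_retainedSet]
    exact and_congr_right (h2 b u)
  have h4 : D.nbhd b v \ D.retainedSet K f = D.nbhd b v \ D.retainedSet K g := by
    ext u
    simp only [Finset.mem_sdiff, mem_retainedSet]
    exact and_congr_right fun hu => not_congr (h2 b u hu)
  rw [h3, h4, Finset.image_congr fun u hu => h1 b u (Finset.mem_inter.mp hu).1]

/-- Every vertex of `N` that receives a live colour of an earlier part of `N` repeats a colour. -/
theorem card_image_add_card_hits_le {f : V → α} {N Y : Finset V} {X Z : V → Finset V}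
    {b : V → Bool} (hY : Y ⊆ N) (hX : ∀ y ∈ Y, ∀ x ∈ X y, x ∈ N ∧ x < y)
    (hZ : ∀ y ∈ Y, Z y = D.prior (b y) y) :
    ((N ∩ D.retainedSet K f).image f).card +
      (Y.filter fun y => f y ∈ D.liveColours K f (X y) (Z y)).card ≤
      (N ∩ D.retainedSet K f).card := by
  set T := Y.filter fun y => f y ∈ D.liveColours K f (X y) (Z y) with hT
  have hTsub : T ⊆ N ∩ D.retainedSet K f := by
    intro y hy
    obtain ⟨hyY, hy⟩ := Finset.mem_filter.mp hy
    obtain ⟨hK, -, hz⟩ := mem_liveColours.mp hy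
    rw [hZ y hyY] at hz
    exact Finset.mem_inter.mpr ⟨hY hyY, mem_retainedSet.mpr ⟨hK, b y, hz⟩⟩
  have himg : (N ∩ D.retainedSet K f).image f ⊆ ((N ∩ D.retainedSet K f) \ T).image f := by
    intro c hc
    -- The first retained vertex of colour `c` is not in `T`.
    obtain ⟨v, hv, hvc⟩ := Finset.mem_image.mp hc
    set W := (N ∩ D.retainedSet K f).filter (f · = c) with hW
    have hWne : W.Nonempty := ⟨v, Finset.mem_filter.mpr ⟨hv, hvc⟩⟩
    obtain ⟨hu, huc⟩ := Finset.mem_filter.mp (W.min'_mem hWne)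
    refine Finset.mem_image.mpr ⟨W.min' hWne, Finset.mem_sdiff.mpr ⟨hu, fun huT => ?_⟩, huc⟩
    obtain ⟨huY, huL⟩ := Finset.mem_filter.mp huT
    obtain ⟨-, ⟨x, hx, hxr, hxc⟩, -⟩ := mem_liveColours.mp huL
    obtain ⟨hxN, hxlt⟩ := hX _ huY x hx
    have hxW : x ∈ W := Finset.mem_filter.mpr
      ⟨Finset.mem_inter.mpr ⟨hxN, mem_retainedSet.mpr hxr⟩, hxc.trans huc⟩
    exact absurd (W.min'_le x hxW) (not_le.mpr hxlt)
  have h1 := (Finset.card_le_card himg).trans Finset.card_image_le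
  rw [Finset.card_sdiff_of_subset hTsub] at h1
  have h2 := Finset.card_le_card hTsub
  omega

/-- The vertices of `N` before `y` to which `y` has no arc (for `true`), or which have no arc
to `y` (for `false`). -/
def priorNonNbrs (D : Digraph V) (N : Finset V) (b : Bool) (y : V) : Finset V :=
  (N.filter (· < y)) \ D.nbhd b y

/-- Every ordered pair of distinct vertices of `N` is an arc or is counted at its later vertex. -/
theorem card_mul_card_le (N : Finset V) : N.card * N.card ≤ D.arcCount N + N.card +
    ∑ y ∈ N, ((D.priorNonNbrs N true y).card + (D.priorNonNbrs N false y).card) := by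
  classical
  rw [Finset.sum_add_distrib]
  have h1 : ∀ b, ∑ y ∈ N, (D.priorNonNbrs N b y).card =
      (N.sigma fun y => D.priorNonNbrs N b y).card := fun b => (Finset.card_sigma _ _).symm
  have h2 : N.diag.card = N.card := Finset.diag_card N
  rw [h1, h1, ← Finset.card_product, arcCount]
  rw [← h2]
  have hcov : N ×ˢ N ⊆ ((N ×ˢ N).filter fun p => D.Adj p.1 p.2) ∪ N.diag ∪
      (((N.sigma fun y => D.priorNonNbrs N true y).image fun p => (p.1, p.2)) ∪
        ((N.sigma fun y => D.priorNonNbrs N false y).image fun p => (p.2, p.1))) := by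
    rintro ⟨p, q⟩ hpq
    have hp : p ∈ N := (Finset.mem_product.mp hpq).1
    have hq : q ∈ N := (Finset.mem_product.mp hpq).2
    by_cases hadj : D.Adj p q
    · exact Finset.mem_union_left _ (Finset.mem_union_left _ (Finset.mem_filter.mpr ⟨hpq, hadj⟩))
    rcases lt_trichotomy p q with hlt | rfl | hlt
    · refine Finset.mem_union_right _ (Finset.mem_union_right _
        (Finset.mem_image.mpr ⟨⟨q, p⟩, ?_, rfl⟩))
      simp [priorNonNbrs, hp, hq, hlt, mem_nbhd_false, hadj]
    · exact Finset.mem_union_left _ (Finset.mem_union_right _ (by simpa using hp))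
    · refine Finset.mem_union_right _ (Finset.mem_union_left _
        (Finset.mem_image.mpr ⟨⟨p, q⟩, ?_, rfl⟩))
      simp [priorNonNbrs, hp, hq, hlt, mem_nbhd_true, hadj]
  refine (Finset.card_le_card hcov).trans ((Finset.card_union_le _ _).trans ?_)
  refine add_le_add (Finset.card_union_le _ _) ((Finset.card_union_le _ _).trans ?_)
  exact add_le_add Finset.card_image_le Finset.card_image_le

theorem exists_add_le_two_mul_card_priorNonNbrs (N : Finset V) (y : V) :
    ∃ b, (D.priorNonNbrs N true y).card + (D.priorNonNbrs N false y).card ≤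
      2 * (D.priorNonNbrs N b y).card := by
  rcases le_total (D.priorNonNbrs N true y).card (D.priorNonNbrs N false y).card with h | h
  exacts [⟨false, by omega⟩, ⟨true, by omega⟩]

end BadEvents

end Digraph

/-! ### Probability of a bad event -/

namespace Digraph

open Finset Function

variable {V α : Type*} [Fintype V] [LinearOrder V] [Fintype α] [DecidableEq α]
  {D : Digraph V} {K : Finset α}

/-- Sparseness survives restricting to those `y` that have at least `β / 10` earlier
non-neighbours, where `b` picks the better direction at each `y`. The hypothesis `Δ - |N| < x` makes
the pairs that `N` lacks because of `|N| < Δ` negligible. -/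
theorem sum_card_large_ge {Δ : ℕ} {β x : ℝ} (hΔ : 0 < Δ) (hxβ : 4000 * x ≤ β) (hx0 : 0 ≤ x)
    {N : Finset V} (hN : N.card ≤ Δ) (hNx : (Δ : ℝ) - N.card < x)
    (hsparse : (D.arcCount N : ℝ) ≤ Δ * (Δ - 1) - β * Δ) {b : V → Bool}
    (hb : ∀ y, (D.priorNonNbrs N true y).card + (D.priorNonNbrs N false y).card ≤
      2 * (D.priorNonNbrs N (b y) y).card) :
    0.39 * β * Δ ≤ ∑ y ∈ N with β / 10 ≤ (D.priorNonNbrs N (b y) y).card,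
      ((D.priorNonNbrs N (b y) y).card : ℝ) := by
  have hΔ' : (1 : ℝ) ≤ Δ := by exact_mod_cast hΔ
  have hN' : (N.card : ℝ) ≤ Δ := by exact_mod_cast hN
  have hd0 : (0 : ℝ) ≤ N.card := by positivity
  set s : V → ℝ := fun y => ((D.priorNonNbrs N (b y) y).card : ℝ) with hs
  have h1 : (N.card : ℝ) * N.card ≤ D.arcCount N + N.card + 2 * ∑ y ∈ N, s y := by
    have := (D.card_mul_card_le N).trans
      (Nat.add_le_add_left (Finset.sum_le_sum fun y _ => hb y) _)
    rw [← Finset.mul_sum] at this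
    simp only [hs]
    exact_mod_cast this
  have h2 : β * Δ - 2 * Δ * x ≤ 2 * ∑ y ∈ N, s y := by
    have h3 : ((Δ : ℝ) - N.card) * (Δ + N.card - 1) ≤ x * (2 * Δ) :=
      mul_le_mul hNx.le (by linarith) (by linarith) hx0
    nlinarith
  have h4 : ∑ y ∈ N, s y ≤ (∑ y ∈ N with β / 10 ≤ s y, s y) + N.card * (β / 10) := by
    rw [← Finset.sum_filter_add_sum_filter_not N fun y => β / 10 ≤ s y]
    refine add_le_add_right ?_ _
    have h5 := Finset.sum_le_card_nsmul (N.filter fun y => ¬ β / 10 ≤ s y) s (β / 10)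
      fun y hy => (not_le.mp (Finset.mem_filter.mp hy).2).le
    rw [nsmul_eq_mul] at h5
    refine h5.trans (mul_le_mul_of_nonneg_right ?_ (by linarith))
    exact_mod_cast Finset.card_le_card (Finset.filter_subset _ _)
  have h6 : (N.card : ℝ) * (β / 10) ≤ Δ * (β / 10) :=
    mul_le_mul_of_nonneg_right hN' (by linarith)
  have h7 : 2 * (Δ : ℝ) * x ≤ 2 * Δ * (β / 4000) :=
    mul_le_mul_of_nonneg_left (by linarith) (by linarith)
  have h8 : 0 ≤ β * Δ := by nlinarith
  linarith

open Classical in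
/-- The probability that greedy completion may fail at a vertex with a sparse neighbourhood. -/
theorem card_stuck_le {Δ : ℕ} {β x : ℝ} (hα : Fintype.card α = 8 * Δ) (hΔ : 0 < Δ)
    (hKle : K.card ≤ Δ) (hKge : (Δ : ℝ) * 0.9995 ≤ K.card)
    (hfloor : ∀ n : ℕ, (n : ℝ) ≤ Δ + 1 - x → n ≤ K.card) (hx0 : 0 ≤ x) (hxβ : 4000 * x ≤ β)
    (hdeg : ∀ b v, (D.nbhd b v).card ≤ Δ) {v : V} {b₀ : Bool}
    (hsparse : (D.arcCount (D.nbhd b₀ v) : ℝ) ≤ Δ * (Δ - 1) - β * Δ) :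
    ((univ.filter (D.Stuck K v)).card : ℝ) ≤
      ((1 + 2 * Δ) * Real.exp (-(Δ : ℝ) / 32) + Δ * Real.exp (-β / 10000) + Real.exp (-β / 6000)) *
        Fintype.card (V → α) := by
  have hΔ' : (0 : ℝ) < Δ := by exact_mod_cast hΔ
  set N := D.nbhd b₀ v with hN
  have hNc : N.card ≤ Δ := hdeg b₀ v
  have hNc' : (N.card : ℝ) ≤ Δ := by exact_mod_cast hNc
  have hsplit : ∀ R : Finset V, (N ∩ R).card + (N \ R).card = N.card := fun R =>
    Finset.card_inter_add_card_sdiff N R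
  rcases le_or_gt x ((Δ : ℝ) - N.card) with hNx | hNx
  · -- The neighbourhood is so small that greedy completion cannot fail.
    have : univ.filter (D.Stuck K v) = ∅ := by
      refine Finset.filter_false_of_mem fun f _ hf => ?_
      have h1 := hf b₀
      have h2 := Finset.card_image_le (s := N ∩ D.retainedSet K f) (f := f)
      have h3 := hsplit (D.retainedSet K f)
      have h4 := hfloor (N.card + 1) (by push_cast; linarith)
      rw [← hN] at h1
      omega
    rw [this, Finset.card_empty, Nat.cast_zero]
    positivity
  obtain ⟨o, ho⟩ : ∃ o, o ∉ K := by
    by_contra! h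
    have := Finset.card_eq_iff_eq_univ K |>.mpr (Finset.eq_univ_iff_forall.mpr h)
    omega
  choose b hb using exists_add_le_two_mul_card_priorNonNbrs (D := D) N
  have hlarge := sum_card_large_ge hΔ hxβ hx0 hNc hNx hsparse hb
  set X : V → Finset V := fun y => D.priorNonNbrs N (b y) y with hX
  set Z : V → Finset V := fun y => D.prior (b y) y with hZ
  set Y := N.filter fun y => β / 10 ≤ ((X y).card : ℝ) with hY
  have hXmem : ∀ y, ∀ u ∈ X y, u ∈ N ∧ u < y := fun y u hu =>
    Finset.mem_filter.mp (Finset.mem_sdiff.mp hu).1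
  set E₁ : Finset V → Finset (V → α) := fun Q =>
    univ.filter fun f : V → α => (Δ : ℝ) / 4 < activity K f Q with hE₁
  set E₂ : V → Finset (V → α) := fun y => univ.filter fun f : V → α =>
    ((activity K f (X y) : ℝ) ≤ Δ / 4 ∧ (activity K f (Z y) : ℝ) ≤ Δ / 4 ∧
      ∀ u ∈ X y, (activity K f (D.prior true u) : ℝ) ≤ Δ / 4) ∧
      ((D.liveColours K f (X y) (Z y)).card : ℝ) < (X y).card / 70 with hE₂
  set E₃ : Finset (V → α) := univ.filter fun f : V → α =>
    (∀ y ∈ Y, ((X y).card : ℝ) / 70 ≤ (D.liveColours K f (X y) (Z y)).card) ∧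
      ((Y.filter fun y => f y ∈ D.liveColours K f (X y) (Z y)).card : ℝ) < x with hE₃
  have hE₁card : ∀ Q : Finset V, Q.card ≤ Δ →
      ((E₁ Q).card : ℝ) ≤ Real.exp (-(Δ : ℝ) / 32) * Fintype.card (V → α) := fun Q hQ =>
    card_activity_gt_le hα hKle hΔ Q hQ
  have hE₂card : ∀ y ∈ Y, ((E₂ y).card : ℝ) ≤
      Real.exp (-β / 10000) * Fintype.card (V → α) := fun y hy => by
    have hdisj : Disjoint (X y) (Z y) := Finset.disjoint_left.mpr fun u hu hu' =>
      (Finset.mem_sdiff.mp hu).2 (Finset.mem_filter.mp hu').1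
    have hZc : (Z y).card ≤ Δ := (Finset.card_le_card (Finset.filter_subset _ _)).trans (hdeg _ _)
    refine (card_liveColours_lt_le hα hΔ hKge ho hdisj hZc true).trans ?_
    refine mul_le_mul_of_nonneg_right (Real.exp_le_exp.mpr ?_) (by positivity)
    have := (Finset.mem_filter.mp hy).2
    linarith
  have hE₃card : (E₃.card : ℝ) ≤ Real.exp (-β / 6000) * Fintype.card (V → α) := by
    refine (card_hits_lt_le (fun y _ u hu => (hXmem y u hu).2) (fun y _ z hz => lt_of_mem_prior hz)
      (fun y => ((X y).card : ℝ) / 70) x (by omega)).trans ?_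
    refine mul_le_mul_of_nonneg_right (Real.exp_le_exp.mpr ?_) (by positivity)
    have hMr : (Fintype.card α : ℝ) = 8 * Δ := by exact_mod_cast hα
    rw [← Finset.sum_div, hMr, div_div]
    have h1 : 0.39 * β / 560 ≤ (∑ y ∈ Y, ((X y).card : ℝ)) / (70 * (8 * Δ)) := by
      rw [le_div_iff₀ (by positivity)]
      linarith
    linarith
  have hcov : univ.filter (D.Stuck K v) ⊆
      ((E₁ N ∪ N.biUnion fun y => E₁ (D.nbhd true y) ∪ E₁ (D.nbhd false y)) ∪ Y.biUnion E₂) ∪ E₃ := by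
    intro f hf
    by_contra hcon
    simp only [Finset.mem_union, Finset.mem_biUnion, not_or, not_exists, not_and] at hcon
    obtain ⟨⟨⟨hN1, hN2⟩, hN3⟩, hN4⟩ := hcon
    have hact : ∀ Q, f ∉ E₁ Q → (activity K f Q : ℝ) ≤ Δ / 4 := fun Q hQ => by
      simpa [hE₁] using hQ
    have hmono : ∀ {Q Q' : Finset V}, Q ⊆ Q' → f ∉ E₁ Q' → (activity K f Q : ℝ) ≤ Δ / 4 :=
      fun h hQ => le_trans (by exact_mod_cast activity_mono h) (hact _ hQ)
    have hnb : ∀ y ∈ N, ∀ c, f ∉ E₁ (D.nbhd c y) := fun y hy c => by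
      cases c
      exacts [(hN2 y hy).2, (hN2 y hy).1]
    have hprior : ∀ y ∈ N, ∀ c, (activity K f (D.prior c y) : ℝ) ≤ Δ / 4 := fun y hy c =>
      hmono (Finset.filter_subset _ _) (hnb y hy c)
    have hlive : ∀ y ∈ Y, ((X y).card : ℝ) / 70 ≤ (D.liveColours K f (X y) (Z y)).card := by
      intro y hy
      by_contra! hlt
      have hyN := (Finset.mem_filter.mp hy).1
      refine hN3 y hy (Finset.mem_filter.mpr ⟨Finset.mem_univ _, ⟨?_, hprior y hyN _, ?_⟩, hlt⟩)
      · exact hmono (fun u hu => (hXmem y u hu).1) hN1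
      · exact fun u hu => hprior u (hXmem y u hu).1 _
    have hhits : x ≤ (Y.filter fun y => f y ∈ D.liveColours K f (X y) (Z y)).card := by
      by_contra! hlt
      exact hN4 (Finset.mem_filter.mpr ⟨Finset.mem_univ _, hlive, hlt⟩)
    have h1 := (Finset.mem_filter.mp hf).2 b₀
    have h2 := card_image_add_card_hits_le (D := D) (K := K) (f := f) (N := N) (Y := Y)
      (X := X) (Z := Z) (b := b) (Finset.filter_subset _ _) (fun y _ => hXmem y) fun _ _ => rfl
    have h3 := hsplit (D.retainedSet K f)
    rw [← hN] at h1
    set T := (Y.filter fun y => f y ∈ D.liveColours K f (X y) (Z y)).card with hT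
    have h4 := hfloor (N.card + 1 - T) (by
      rw [Nat.cast_sub (by omega)]
      push_cast
      linarith)
    omega
  have hNbi : ((N.biUnion fun y => E₁ (D.nbhd true y) ∪ E₁ (D.nbhd false y)).card : ℝ) ≤
      Δ * (2 * (Real.exp (-(Δ : ℝ) / 32) * Fintype.card (V → α))) := by
    refine le_trans (Nat.cast_le.mpr Finset.card_biUnion_le) ?_
    push_cast
    refine (Finset.sum_le_card_nsmul N _
      (2 * (Real.exp (-(Δ : ℝ) / 32) * Fintype.card (V → α))) fun y _ => ?_).trans ?_
    · refine le_trans (Nat.cast_le.mpr (Finset.card_union_le _ _)) ?_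
      push_cast
      linarith [hE₁card _ (hdeg true y), hE₁card _ (hdeg false y)]
    · rw [nsmul_eq_mul]
      exact mul_le_mul_of_nonneg_right hNc' (by positivity)
  have hYbi : ((Y.biUnion E₂).card : ℝ) ≤
      Δ * (Real.exp (-β / 10000) * Fintype.card (V → α)) := by
    refine le_trans (Nat.cast_le.mpr Finset.card_biUnion_le) ?_
    push_cast
    refine (Finset.sum_le_card_nsmul Y _ _ hE₂card).trans ?_
    rw [nsmul_eq_mul]
    refine mul_le_mul_of_nonneg_right (le_trans ?_ hNc') (by positivity)
    exact_mod_cast Finset.card_le_card (Finset.filter_subset _ _)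
  have hfin : ((univ.filter (D.Stuck K v)).card : ℝ) ≤ (E₁ N).card +
      (N.biUnion fun y => E₁ (D.nbhd true y) ∪ E₁ (D.nbhd false y)).card +
      (Y.biUnion E₂).card + E₃.card := by
    exact_mod_cast (Finset.card_le_card hcov).trans ((Finset.card_union_le _ _).trans
      (Nat.add_le_add_right ((Finset.card_union_le _ _).trans
        (Nat.add_le_add_right (Finset.card_union_le _ _) _)) _))
  have := hE₁card N hNc
  linarith

/-! ### Parameters and the local lemma -/

/-- The numerical condition of the local lemma. -/
theorem four_mul_prob_mul_degree_le {Δ : ℕ} {β : ℝ} (hΔ : Real.exp 1000 ≤ Δ)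
    (hβ : Real.log Δ ^ 3 ≤ β) :
    4 * ((1 + 2 * Δ) * Real.exp (-(Δ : ℝ) / 32) + Δ * Real.exp (-β / 10000) +
      Real.exp (-β / 6000)) * (36 * Δ ^ 4 : ℕ) ≤ 1 := by
  have hΔ0 : (0 : ℝ) < Δ := (Real.exp_pos _).trans_le hΔ
  set u := Real.log Δ with hu
  have hu1 : 1000 ≤ u := (Real.le_log_iff_exp_le hΔ0).mpr hΔ
  have hexp : Real.exp u = Δ := Real.exp_log hΔ0
  have hΔ1 : (1001 : ℝ) ≤ Δ := by linarith [Real.add_one_le_exp (1000 : ℝ)]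
  have hΔu : u ^ 2 / 2 ≤ Δ := by
    have := Real.quadratic_le_exp_of_nonneg (x := u) (by linarith)
    linarith
  have hpow : Real.exp (-(7 * u)) = ((Δ : ℝ) ^ 7)⁻¹ := by
    rw [Real.exp_neg, ← hexp, ← Real.exp_nat_mul]
    norm_num
  have hu3 : 1000000 * u ≤ u ^ 3 := by nlinarith [mul_self_nonneg (u - 1000)]
  have h1 : Real.exp (-(Δ : ℝ) / 32) ≤ ((Δ : ℝ) ^ 7)⁻¹ := by
    rw [← hpow, Real.exp_le_exp]
    nlinarith
  have h2 : Real.exp (-β / 10000) ≤ ((Δ : ℝ) ^ 7)⁻¹ := by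
    rw [← hpow, Real.exp_le_exp]
    linarith
  have h3 : Real.exp (-β / 6000) ≤ ((Δ : ℝ) ^ 7)⁻¹ := by
    rw [← hpow, Real.exp_le_exp]
    linarith
  have h4 : (1 + 2 * Δ) * Real.exp (-(Δ : ℝ) / 32) + Δ * Real.exp (-β / 10000) +
      Real.exp (-β / 6000) ≤ 5 * Δ * ((Δ : ℝ) ^ 7)⁻¹ := by
    have h5 := mul_le_mul_of_nonneg_left h1 (show (0 : ℝ) ≤ 1 + 2 * Δ by positivity)
    have h6 := mul_le_mul_of_nonneg_left h2 hΔ0.le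
    have h7 : 2 * ((Δ : ℝ) ^ 7)⁻¹ ≤ 2 * Δ * ((Δ : ℝ) ^ 7)⁻¹ :=
      mul_le_mul_of_nonneg_right (by linarith) (by positivity)
    linarith
  have h8 : (0 : ℝ) ≤ (36 * Δ ^ 4 : ℕ) := by positivity
  refine (mul_le_mul_of_nonneg_right (mul_le_mul_of_nonneg_left h4 (by norm_num)) h8).trans ?_
  push_cast
  have h9 : 4 * (5 * (Δ : ℝ) * ((Δ : ℝ) ^ 7)⁻¹) * (36 * (Δ : ℝ) ^ 4) = 720 / (Δ : ℝ) ^ 2 := by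
    field_simp
    norm_num
  rw [h9, div_le_one (by positivity)]
  nlinarith

theorem thousand_le_exp_one_pow_seven : (1000 : ℝ) ≤ Real.exp 1 ^ 7 := by
  have h : (2.7 : ℝ) ≤ Real.exp 1 := by have := Real.exp_one_gt_d9; linarith
  exact le_trans (by norm_num) (pow_le_pow_left₀ (by norm_num) h 7)

end Digraph

end

theorem theorem1p6 :
    ∃ Δ₀ : ℕ, 1 ≤ Δ₀ ∧
      ∀ (V : Type*) [Fintype V] (D : Digraph V), D.IsLoopless →
        ∀ Δ : ℕ, D.maxDeg = Δ → Δ₀ < Δ →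
          ∀ B : ℝ, (Δ : ℝ) * Real.log (Δ : ℝ) ^ 3 < B → D.IsSparse B →
            (D.dichromaticNumber : ℝ) ≤
              ((Δ : ℝ) + 1) - B / (4 * Real.exp 1 ^ 7 * (Δ : ℝ)) := by
  refine ⟨⌈Real.exp 1000⌉₊, Nat.one_le_iff_ne_zero.mpr (by positivity), ?_⟩
  intro V _ D hD Δ hmax hΔ₀ B hB hsparse
  classical
  let _ : LinearOrder V := LinearOrder.lift' (Fintype.equivFin V) (Fintype.equivFin V).injective
  have hΔexp : Real.exp 1000 ≤ Δ := (Nat.le_ceil _).trans (by exact_mod_cast hΔ₀.le)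
  have hΔ : 0 < Δ := by omega
  have hΔr : (0 : ℝ) < Δ := by exact_mod_cast hΔ
  have hlog : 0 < Real.log Δ := lt_of_lt_of_le (by norm_num)
    ((Real.le_log_iff_exp_le hΔr).mpr hΔexp)
  have he := Digraph.thousand_le_exp_one_pow_seven
  set β : ℝ := B / Δ with hβ
  have hBβ : B = β * Δ := by rw [hβ, div_mul_cancel₀ _ hΔr.ne']
  have hβlog : Real.log Δ ^ 3 < β := by
    rw [hβ, lt_div_iff₀ hΔr, mul_comm]
    exact hB
  have hβ0 : 0 < β := (pow_pos hlog 3).trans hβlog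
  set x : ℝ := B / (4 * Real.exp 1 ^ 7 * (Δ : ℝ)) with hx
  have hxβ' : x = β / (4 * Real.exp 1 ^ 7) := by rw [hx, hβ, div_div, mul_comm (Δ : ℝ)]
  have hx0 : 0 < x := by rw [hxβ']; positivity
  have hxβ : 4000 * x ≤ β := by
    rw [hxβ', ← mul_div_assoc, div_le_iff₀ (by positivity)]
    nlinarith
  obtain ⟨v₀⟩ : Nonempty V := by
    by_contra h
    rw [not_nonempty_iff] at h
    have : D.maxDeg = 0 := by simp [Digraph.maxDeg, Finset.univ_eq_empty]
    omega
  have hβΔ : β ≤ Δ := by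
    have h1 := hsparse v₀
    rw [hmax] at h1
    have h2 : (0 : ℝ) ≤ (min (D.arcCount (D.outNbhd v₀)) (D.arcCount (D.inNbhd v₀)) : ℕ) := by
      positivity
    have h3 : β * Δ ≤ Δ * Δ := by linarith
    exact le_of_mul_le_mul_right h3 hΔr
  set k := ⌊(Δ : ℝ) + 1 - x⌋₊ with hk
  have hk1 : (k : ℝ) ≤ Δ + 1 - x := Nat.floor_le (by linarith)
  have hk2 : (Δ : ℝ) + 1 - x < k + 1 := Nat.lt_floor_add_one _
  have hkΔ : k ≤ Δ := by
    have : (k : ℝ) < Δ + 1 := by linarith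
    exact_mod_cast Nat.lt_succ_iff.mp (by exact_mod_cast this)
  obtain ⟨K, -, hK⟩ := Finset.exists_subset_card_eq
    (s := (Finset.univ : Finset (Fin (8 * Δ)))) (n := k) (by rw [Finset.card_fin]; omega)
  have hdeg : ∀ b v, (D.nbhd b v).card ≤ Δ := fun b v => hmax ▸ Digraph.card_nbhd_le_maxDeg b v
  have hα : Fintype.card (Fin (8 * Δ)) = 8 * Δ := Fintype.card_fin _
  have : Nonempty (Fin (8 * Δ)) := Fintype.card_pos_iff.mp (by omega)
  have hprob : ∀ v, ((Finset.univ.filter (D.Stuck K v)).card : ℝ) ≤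
      ((1 + 2 * Δ) * Real.exp (-(Δ : ℝ) / 32) + Δ * Real.exp (-β / 10000) + Real.exp (-β / 6000)) *
        Fintype.card (V → Fin (8 * Δ)) := by
    intro v
    have hv : ∃ b, (D.arcCount (D.nbhd b v) : ℝ) ≤ Δ * (Δ - 1) - β * Δ := by
      have h1 := hsparse v
      rw [hmax, hBβ] at h1
      rcases min_choice (D.arcCount (D.outNbhd v)) (D.arcCount (D.inNbhd v)) with h | h
      · exact ⟨true, by rw [h] at h1; exact h1⟩
      · exact ⟨false, by rw [h] at h1; exact h1⟩
    obtain ⟨b, hb⟩ := hv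
    exact Digraph.card_stuck_le hα hΔ (hK.trans_le hkΔ) (by rw [hK]; linarith)
      (fun n hn => hK.symm ▸ Nat.le_floor hn) hx0.le hxβ hdeg hb
  obtain ⟨f, hf⟩ := LocalLemma.exists_forall_notMem
    (A := fun v => Finset.univ.filter (D.Stuck K v)) (S := D.within2)
    (Γ := fun v => (D.within2 v).biUnion D.within2) (d := 36 * Δ ^ 4)
    (fun v f g hfg hf => by
      rw [Finset.mem_filter] at hf ⊢
      exact ⟨Finset.mem_univ _, (Digraph.stuck_congr hfg).mp hf.2⟩)
    (fun v w hw => Finset.disjoint_left.mpr fun u hu hu' =>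
      hw (Finset.mem_biUnion.mpr ⟨u, hu, Digraph.mem_within2_comm.mp hu'⟩))
    (fun v => by
      refine (Finset.card_biUnion_le_card_mul _ _ (6 * Δ ^ 2)
        fun u _ => Digraph.card_within2_le hdeg u).trans ?_
      refine (Nat.mul_le_mul_right _ (Digraph.card_within2_le hdeg v)).trans (le_of_eq ?_)
      ring)
    hprob (Digraph.four_mul_prob_mul_degree_le hΔexp hβlog.le) (by positivity)
    (Nat.one_le_iff_ne_zero.mpr (by positivity))
  obtain ⟨c, hcK, hc⟩ := Digraph.exists_extension hD K Finset.univ (D.retainedSet K f) f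
    (fun v _ => Finset.mem_univ v) (fun v hv => (Digraph.mem_retainedSet.mp hv).1)
    (fun i => by
      simpa only [Digraph.mem_retainedSet] using Digraph.isAcyclicOn_retained hD K f i)
    (fun v => by
      by_contra hcon
      push Not at hcon
      exact hf v (Finset.mem_filter.mpr ⟨Finset.mem_univ _, hcon⟩))
  have hchi := Digraph.dichromaticNumber_le_card K hcK hc
  rw [hK] at hchi
  exact le_trans (by exact_mod_cast hchi) hk1
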